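/- A *pBPP* is a triple $\mathcal{S} = (\Gamma, \to, \mathit{Prob})$, where $\Gamma$ is a finite set of types, $\to\ \subseteq \Gamma \times \mathbb{N}^\Gamma$ is a finite set of rules containing at least one rule $X \to \beta$ for every $X \in \Gamma$, and $\mathit{Prob}$ assigns to each rule a probability in $(0,1] \cap \mathbb{Q}$ such that for every $X \in \Gamma$ the probabilities of the rules with left-hand side $X$ sum to $1$. Its induced Markov decision process has state space $\mathbb{N}^\Gamma$. In a configuration $\alpha \neq 0$ the enabled actions are the types $X$ with $\alpha(X) \geq 1$; choosing $X$ leads to $\alpha - X + \beta$ with probability $\mathit{Prob}(X \to \beta)$ for each rule $X \to \beta$. In the empty configuration $0$ only a fresh action $\bot$ is enabled, and it loops in $0$. A scheduler $\sigma$ maps each history $\alpha_0 a_1 \alpha_1 \cdots a_m \alpha_m$ to a probability distribution over the actions enabled in $\alpha_m$; together with an initial configuration $\alpha_0$ it induces a probability measure $\mathbb{P}_\sigma$ on the runs $\alpha_0 a_1 \alpha_1 a_2 \cdots$ from $\alpha_0$. For $k \in \mathbb{N}$, a run $\alpha_0 a_1 \alpha_1 a_2 \cdots$ is *$k$-fair*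 if for all $i \geq 0$ and all $X \in \Gamma$ with $\alpha_i(X) \geq 1$ we have $X \in \{a_{i+1}, \ldots, a_{i+k}\}$. A scheduler is *$k$-fair* (from $\alpha_0$) if $\mathbb{P}_\sigma$-almost every run from $\alpha_0$ is $k$-fair. **Theorem.** The following problem is decidable: given a pBPP $\mathcal{S}$, an upward-closed set $F \subseteq \mathbb{N}^\Gamma$ (represented by finitely many configurations $\phi_1, \ldots, \phi_m$ with $F = \{\beta \mid \beta \geq \phi_i \text{ for some } i\}$, where $\geq$ is componentwise), a configuration $\alpha_0 \in \mathbb{N}^\Gamma$ and a number $k \in \mathbb{N}$, does every $k$-fair scheduler $\sigma$ reach $F$ from $\alpha_0$ with probability $1$, that is, does $\mathbb{P}_\sigma(\text{some } \alpha_i \in F) = 1$ hold for all $k$-fair schedulers $\sigma$? -/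

import Mathlib

open MeasureTheory ProbabilityTheory

/-! ### Markov decision processes -/

/-- A Markov decision process with states `Q` and actions `A`. The value `trans s a` is
only meaningful for `a ∈ enabled s`; schedulers never choose an action that is not enabled. -/
structure MDP (Q A : Type) where
  enabled : Q → Set A
  enabled_nonempty : ∀ s, (enabled s).Nonempty
  trans : Q → A → PMF Q

namespace MDP

/-- One step `(sᵢ, aᵢ₊₁)` of a run `s₀ a₁ s₁ a₂ ⋯`: the current state and the action chosen in
it. A run is a sequence `ℕ → Step Q A`. -/
@[ext]
structure Step (Q A : Type) where
  state : Q
  act : A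

/-- States and actions are discrete, so every set of steps is measurable. The product
`σ`-algebra on `ℕ → Step Q A` is then the one generated by the cylinders. -/
instance (Q A : Type) : MeasurableSpace (Step Q A) := ⊤

instance (Q A : Type) : DiscreteMeasurableSpace (Step Q A) := ⟨fun _ => trivial⟩

instance (Q A : Type) [Countable Q] [Countable A] : Countable (Step Q A) :=
  Function.Injective.countable (f := fun x : Step Q A => (x.state, x.act))
    (fun _ _ h => Step.ext (congrArg Prod.fst h) (congrArg Prod.snd h))

variable {Q A : Type}

/-- A history `s₀ a₁ s₁ ⋯ aₘ sₘ`, stored as the list `(s₀, a₁), …, (sₘ₋₁, aₘ)` together with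
the last state `sₘ`. -/
abbrev History (Q A : Type) : Type := List (Step Q A) × Q

/-- A (randomised, history-dependent) scheduler: it maps each history to a probability
distribution over the actions enabled in the last state. -/
structure Scheduler (D : MDP Q A) where
  choose : History Q A → PMF A
  support_subset : ∀ w : History Q A, (choose w).support ⊆ D.enabled w.2

/-- The law of the first step from `s₀`: the state is `s₀` and the action is drawn by `σ`. -/
noncomputable def firstStep (D : MDP Q A) (σ : D.Scheduler) (s₀ : Q) : PMF (Step Q A) :=
  (σ.choose ([], s₀)).map (fun b => ⟨s₀, b⟩)

/-- The law of the next step after the steps `(s₀, a₁), …, (sₘ, aₘ₊₁)`, where `pre` lists all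
of these steps and `cur` is the last one: the new state `t` is drawn from `trans sₘ aₘ₊₁`, then
the next action is drawn by `σ` from the history `s₀ a₁ ⋯ sₘ aₘ₊₁ t`. -/
noncomputable def nextStep (D : MDP Q A) (σ : D.Scheduler) (pre : List (Step Q A))
    (cur : Step Q A) : PMF (Step Q A) :=
  (D.trans cur.state cur.act).bind fun t => (σ.choose (pre, t)).map fun b => ⟨t, b⟩

/-- The transition kernel from the steps with index `≤ m` to the step with index `m + 1`. -/
noncomputable def stepKernel [Countable Q] [Countable A] (D : MDP Q A) (σ : D.Scheduler) (m : ℕ) :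
    Kernel (Π _ : Finset.Iic m, Step Q A) (Step Q A) where
  toFun h := (D.nextStep σ
    (List.ofFn fun i : Fin (m + 1) => h ⟨i, Finset.mem_Iic.2 (Nat.lt_succ_iff.1 i.2)⟩)
    (h ⟨m, Finset.mem_Iic.2 le_rfl⟩)).toMeasure
  measurable' := Measurable.of_discrete

instance [Countable Q] [Countable A] (D : MDP Q A) (σ : D.Scheduler) (m : ℕ) :
    IsMarkovKernel (D.stepKernel σ m) :=
  ⟨fun _ => PMF.toMeasure.isProbabilityMeasure _⟩

/-- The probability measure on runs induced by the scheduler `σ` and the initial state `s₀`. -/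
noncomputable def runMeasure [Countable Q] [Countable A] (D : MDP Q A) (σ : D.Scheduler)
    (s₀ : Q) : Measure (ℕ → Step Q A) :=
  Kernel.trajMeasure (X := fun _ => Step Q A) (D.firstStep σ s₀).toMeasure (D.stepKernel σ)

/-- The event that a run hits the set `F` of states. -/
def reach (F : Set Q) : Set (ℕ → Step Q A) := {ω | ∃ i, (ω i).state ∈ F}

end MDP

/-! ### Probabilistic basic parallel processes -/

/-- A probabilistic BPP with finite set of types `Γ`. A configuration is a function `Γ → ℕ`, and
the pair `(X, β) ∈ rules` is the rule `X → β`. Only the values of `prob` on `rules` matter. -/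
structure PBPP (Γ : Type) [Fintype Γ] [DecidableEq Γ] where
  rules : Finset (Γ × (Γ → ℕ))
  exists_rule : ∀ X, ∃ β, (X, β) ∈ rules
  prob : Γ × (Γ → ℕ) → ℚ
  prob_pos : ∀ r ∈ rules, 0 < prob r
  prob_le_one : ∀ r ∈ rules, prob r ≤ 1
  sum_prob : ∀ X, ∑ r ∈ rules with r.1 = X, prob r = 1

namespace PBPP

variable {Γ : Type} [Fintype Γ] [DecidableEq Γ]

theorem sum_ruleProb (S : PBPP Γ) (X : Γ) :
    ∑ r ∈ S.rules with r.1 = X, ENNReal.ofReal ((S.prob r : ℚ) : ℝ) = 1 := by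
  rw [← ENNReal.ofReal_sum_of_nonneg, ← Rat.cast_sum, S.sum_prob X]
  · simp
  · intro r hr
    exact_mod_cast (S.prob_pos r (Finset.mem_filter.1 hr).1).le

/-- The distribution on the rules with left-hand side `X`. -/
noncomputable def ruleDist (S : PBPP Γ) (X : Γ) : PMF (Γ × (Γ → ℕ)) :=
  PMF.ofFinset
    (fun r => if r ∈ S.rules.filter (fun r => r.1 = X) then ENNReal.ofReal ((S.prob r : ℚ) : ℝ)
      else 0)
    (S.rules.filter fun r => r.1 = X)
    (by rw [Finset.sum_congr rfl fun r hr => if_pos hr]; exact S.sum_ruleProb X)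
    (fun _ hr => if_neg hr)

/-- The MDP induced by a pBPP. The actions are the types (`some X`) and the fresh action `⊥`
(`none`), which is enabled exactly in the empty configuration and loops there. In a configuration
`α` with `α X ≥ 1`, the action `some X` leads to `α - X + β` with the probability of the rule
`X → β`. -/
noncomputable def mdp (S : PBPP Γ) : MDP (Γ → ℕ) (Option Γ) where
  enabled α := {a | (a = none ∧ α = 0) ∨ ∃ X, a = some X ∧ 1 ≤ α X}
  enabled_nonempty α := by
    by_cases h : α = 0
    · exact ⟨none, Or.inl ⟨rfl, h⟩⟩
    · obtain ⟨X, hX⟩ := Function.ne_iff.1 h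
      exact ⟨some X, Or.inr ⟨X, rfl, Nat.one_le_iff_ne_zero.2 hX⟩⟩
  trans α a := match a with
    | none => PMF.pure α
    | some X => (S.ruleDist X).map fun r => α - Pi.single X 1 + r.2

/-- A run `α₀ a₁ α₁ a₂ ⋯` is `k`-fair if, whenever `αᵢ X ≥ 1`, the type `X` is among the
actions `aᵢ₊₁, …, aᵢ₊ₖ`. -/
def KFairRun (k : ℕ) (ω : ℕ → MDP.Step (Γ → ℕ) (Option Γ)) : Prop :=
  ∀ (i : ℕ) (X : Γ), 1 ≤ (ω i).state X → ∃ j < k, (ω (i + j)).act = some X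

/-- A scheduler is `k`-fair (from the initial configuration `α₀`) if its runs from `α₀` are
almost surely `k`-fair. -/
def KFair (S : PBPP Γ) (α₀ : Γ → ℕ) (k : ℕ) (σ : S.mdp.Scheduler) : Prop :=
  ∀ᵐ ω ∂(S.mdp.runMeasure σ α₀), KFairRun k ω

/-- The `k`-fair universal coverability property: every `k`-fair scheduler reaches `F` from `α₀`
with probability `1`. -/
def KFairUniversal (S : PBPP Γ) (F : Set (Γ → ℕ)) (α₀ : Γ → ℕ) (k : ℕ) : Prop :=
  ∀ σ : S.mdp.Scheduler, S.KFair α₀ k σ → S.mdp.runMeasure σ α₀ (MDP.reach F) = 1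

/-! ### Problem instances as finite data -/

/-- Finite data describing an instance: the number of types; the list of rules, each with its
left-hand side, its right-hand side, and numerator and denominator of its probability; a list of
configurations generating the target set; the initial configuration; the fairness bound. -/
abbrev InstanceCode : Type :=
  ℕ × List (ℕ × List ℕ × ℕ × ℕ) × List (List ℕ) × List ℕ × ℕ

/-- The code of an instance, with the rules of `S` listed as `L`. A configuration `α` is written
as the list `α 0, …, α (n - 1)`. -/
def instanceCode {n : ℕ} (S : PBPP (Fin n)) (L : List (Fin n × (Fin n → ℕ)))
    (Φ : List (Fin n → ℕ)) (α₀ : Fin n → ℕ) (k : ℕ) : InstanceCode :=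
  (n, L.map (fun r => ((r.1 : ℕ), List.ofFn r.2, (S.prob r).num.natAbs, (S.prob r).den)),
    Φ.map (fun φ => List.ofFn φ), List.ofFn α₀, k)

end PBPP

/-! ### The fairness game on configurations with waiting times -/

/-! Only the support of the probabilities matters: the problem reduces to a game on configurations
paired with waiting times, in which the scheduler picks a present type and an adversary picks the
rule. A position is bad if it lies in `F` or if a present type has already waited `k` steps. `Safe R
Φ k` says that the scheduler can avoid bad positions forever against every adversary; with `[]` in
place of `Φ` this is the possibility of staying `k`-fair. A scheduler that misses `F` with positive
probability exists iff `CanReach` holds initially: a cooperating adversary leads through positions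
outside `F` to a `Safe` one, while every other outcome of the moves made remains safe for fairness.

Given such a path, the scheduler follows it, falls back on a fairness strategy when the rules
deviate, and keeps to the safe region once inside. The path has finitely many steps, so it is
followed with positive probability, and `F` is then never hit. Conversely, if `CanReach` fails, it
fails at every position that a `k`-fair scheduler visits before `F`, so none of these positions is
safe. Non-safe positions lose within a number `N` of steps that does not depend on the position
(`exists_uniform_lose`). Since a `k`-fair scheduler never becomes late, `F` is hit with conditional
probability at least `p ^ N` from every such history, hence almost surely.

The uniform bound and decidability both rest on monotonicity. Having fewer tokens and shorter
waiting times never hurts the scheduler: it imitates the play from the larger position and skips the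
moves of types that it does not have. Fewer than `k` moves are skipped in a row, because some
present type waits meanwhile. So `Safe` and `CanReach` are downward closed, and by Dickson's lemma
their complements have finite bases. This gives finite certificates for `CanReach`
(`canReach_iff_exists_cert`) and for its negation (`not_canReach_iff_exists_cert`). Checking them is
primitive recursive, and searching for both kinds at once decides the problem. -/

namespace FairGame

/-- A configuration together with, for each type, the number of steps for which that type has been
present without being scheduled. -/
abbrev Cfg (Γ : Type) : Type := (Γ → ℕ) × (Γ → ℕ)

/-- The simulation order: `m` has fewer tokens than `q`, and its types have waited less. -/
def Below {Γ : Type} (m q : Cfg Γ) : Prop :=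
  ∀ X, m.1 X ≤ q.1 X ∧ (1 ≤ m.1 X → m.2 X ≤ q.2 X)

/-- The configuration is in the target set generated by `Φ`, or some type has waited too long. -/
def Bad {Γ : Type} (Φ : List (Γ → ℕ)) (k : ℕ) (q : Cfg Γ) : Prop :=
  (∃ φ ∈ Φ, φ ≤ q.1) ∨ ∃ X, 1 ≤ q.1 X ∧ k ≤ q.2 X

section Order

variable {Γ : Type} {m q : Cfg Γ} {Φ : List (Γ → ℕ)} {k : ℕ}

theorem Below.refl (q : Cfg Γ) : Below q q := fun _ => ⟨le_rfl, fun _ => le_rfl⟩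

theorem Below.trans {p : Cfg Γ} (h : Below m q) (h' : Below q p) : Below m p := fun X =>
  ⟨(h X).1.trans (h' X).1, fun hm => ((h X).2 hm).trans ((h' X).2 (hm.trans (h X).1))⟩

theorem Below.of_le (h : m ≤ q) : Below m q := fun X => ⟨h.1 X, fun _ => h.2 X⟩

theorem Bad.mono (h : Below m q) (hm : Bad Φ k m) : Bad Φ k q := by
  rcases hm with ⟨φ, hφ, hle⟩ | ⟨X, h1, h2⟩
  · exact Or.inl ⟨φ, hφ, fun X => (hle X).trans (h X).1⟩
  · exact Or.inr ⟨X, h1.trans (h X).1, h2.trans ((h X).2 h1)⟩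

theorem bad_of_nil (h : Bad [] k q) : Bad Φ k q :=
  Or.inr (h.resolve_left (by simp))

/-- Upward-closed sets of configurations with waiting times are finitely generated. -/
theorem exists_basis [Finite Γ] {U : Set (Cfg Γ)} (hU : IsUpperSet U) :
    ∃ M : List (Cfg Γ), ∀ q, q ∈ U ↔ ∃ m ∈ M, m ≤ q := by
  -- Dickson's lemma: the product order on pairs of vectors is a well-quasi-order, so the antichain
  -- of minimal elements is finite.
  have hfin : {x | Minimal (· ∈ U) x}.Finite :=
    WellQuasiOrderedLE.finite_of_isAntichain (setOfPred_minimal_antichain _)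
  refine ⟨hfin.toFinset.toList, fun q => ⟨fun hq => ?_, ?_⟩⟩
  · obtain ⟨m, hmq, hm⟩ := exists_minimal_le_of_wellFoundedLT (· ∈ U) q hq
    exact ⟨m, by simpa using hm, hmq⟩
  · rintro ⟨m, hm, hmq⟩
    exact hU hmq (by simpa using hm : Minimal (· ∈ U) m).prop

end Order

/-! ### Moves of the game and monotonicity in the simulation order -/

section Game

variable {Γ : Type} [DecidableEq Γ]

/-- The waiting times after the action `a` is chosen in the configuration `q`. -/
def nextAge (q : Cfg Γ) (a : Option Γ) : Γ → ℕ :=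
  fun X => if a = some X then 0 else if 1 ≤ q.1 X then q.2 X + 1 else 0

/-- The successor of `q` under the rule `r`. -/
def fire (q : Cfg Γ) (r : Γ × (Γ → ℕ)) : Cfg Γ :=
  (q.1 - Pi.single r.1 1 + r.2, nextAge q (some r.1))

/-- The rules can force the play into a bad configuration within `N` steps. -/
def Lose (R : List (Γ × (Γ → ℕ))) (Φ : List (Γ → ℕ)) (k : ℕ) : ℕ → Cfg Γ → Prop
  | 0, q => Bad Φ k q
  | N + 1, q => Bad Φ k q ∨ ((∃ X, 1 ≤ q.1 X) ∧
      ∀ X, 1 ≤ q.1 X → ∃ r ∈ R, r.1 = X ∧ Lose R Φ k N (fire q r))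

/-- The scheduler can surely avoid the bad configurations forever. -/
def Safe (R : List (Γ × (Γ → ℕ))) (Φ : List (Γ → ℕ)) (k : ℕ) (q : Cfg Γ) : Prop :=
  ∀ N, ¬ Lose R Φ k N q

/-- Some play that stays `k`-fair whatever the rules do, and avoids the target, reaches a
configuration that is safe for the target. -/
inductive CanReach (R : List (Γ × (Γ → ℕ))) (Φ : List (Γ → ℕ)) (k : ℕ) : Cfg Γ → Prop
  | safe {q : Cfg Γ} : Safe R Φ k q → CanReach R Φ k q
  | step {q : Cfg Γ} {r : Γ × (Γ → ℕ)} : ¬ Bad Φ k q → r ∈ R → 1 ≤ q.1 r.1 →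
      (∀ r' ∈ R, r'.1 = r.1 → Safe R [] k (fire q r')) → CanReach R Φ k (fire q r) →
      CanReach R Φ k q

/-- Membership in `I` can be maintained, up to the simulation order, without visiting a bad
configuration. -/
def InductiveUpTo (R : List (Γ × (Γ → ℕ))) (Φ : List (Γ → ℕ)) (k : ℕ) (I : Set (Cfg Γ)) : Prop :=
  ∀ q ∈ I, ¬ Bad Φ k q ∧ ((∀ X, q.1 X = 0) ∨
    ∃ X, 1 ≤ q.1 X ∧ ∀ r ∈ R, r.1 = X → ∃ p ∈ I, Below (fire q r) p)

variable {R : List (Γ × (Γ → ℕ))} {Φ : List (Γ → ℕ)} {k : ℕ} {m q : Cfg Γ}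

theorem fire_fst_apply (q : Cfg Γ) (r : Γ × (Γ → ℕ)) (X : Γ) :
    (fire q r).1 X = q.1 X - (if X = r.1 then 1 else 0) + r.2 X := by
  simp [fire, Pi.single_apply]

theorem fire_snd_apply (q : Cfg Γ) (r : Γ × (Γ → ℕ)) (X : Γ) :
    (fire q r).2 X = if r.1 = X then 0 else if 1 ≤ q.1 X then q.2 X + 1 else 0 := by
  simp [fire, nextAge]

theorem Below.fire {r : Γ × (Γ → ℕ)} (h : Below m q) :
    Below (fire m r) (fire q r) := by
  intro X
  have hX := h X
  simp only [fire_fst_apply, fire_snd_apply]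
  split_ifs <;> refine ⟨by omega, fun _ => ?_⟩ <;> grind

/-- A move of a type absent from the smaller position can be skipped there: the consumed token is
not one that `m` needs, and the other waiting times in `q` only grow. -/
theorem Below.skip {r : Γ × (Γ → ℕ)} (h : Below m q) (hr : m.1 r.1 = 0) :
    Below m (FairGame.fire q r) := by
  intro X
  have hX := h X
  simp only [fire_fst_apply, fire_snd_apply]
  by_cases hXr : X = r.1
  · subst hXr
    simp [hr]
  · rw [if_neg hXr, if_neg (Ne.symm hXr)]
    refine ⟨by omega, fun h1 => ?_⟩
    rw [if_pos (h1.trans hX.1)]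
    have := hX.2 h1
    omega

theorem Lose.succ : ∀ {N : ℕ} {q : Cfg Γ}, Lose R Φ k N q → Lose R Φ k (N + 1) q
  | 0, _, h => Or.inl h
  | N + 1, q, h => by
    rcases h with h | ⟨hne, h⟩
    · exact Or.inl h
    · refine Or.inr ⟨hne, fun X hX => ?_⟩
      obtain ⟨r, hr, hrX, hl⟩ := h X hX
      exact ⟨r, hr, hrX, Lose.succ hl⟩

theorem Lose.mono {N N' : ℕ} (hN : N ≤ N') (h : Lose R Φ k N q) : Lose R Φ k N' q := by
  induction hN with
  | refl => exact h
  | step _ ih => exact Lose.succ ih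

theorem Bad.lose (h : Bad Φ k q) (N : ℕ) : Lose R Φ k N q :=
  Lose.mono (Nat.zero_le N) (show Lose R Φ k 0 q from h)

theorem Safe.not_bad (h : Safe R Φ k q) : ¬ Bad Φ k q := h 0

/-- Losing is monotone in the simulation order, up to a uniform change of the number of steps. -/
theorem exists_lose_of_below (hR : ∀ X, ∃ r ∈ R, r.1 = X) (N : ℕ) :
    ∃ N', ∀ m q : Cfg Γ, Lose R Φ k N m → Below m q → Lose R Φ k N' q := by
  induction N with
  | zero => exact ⟨0, fun m q hm hmq => Bad.mono hmq hm⟩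
  | succ N ih =>
    obtain ⟨N', ih⟩ := ih
    refine ⟨N' + k + 1, fun m q hm hmq => ?_⟩
    rcases hm with hm | ⟨⟨X₀, hX₀⟩, hm⟩
    · exact (hm.mono hmq).lose _
    -- `t` bounds the number of skipped moves still possible. While `m` stands still, `X₀` waits in
    -- `q`, so after `t` more skips it is late there.
    · have key : ∀ t q, Below m q → k ≤ q.2 X₀ + t → Lose R Φ k (N' + t + 1) q := by
        intro t
        induction t with
        | zero =>
          intro q hmq ht
          exact Bad.lose (Or.inr ⟨X₀, hX₀.trans (hmq X₀).1, by omega⟩) _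
        | succ t iht =>
          intro q hmq ht
          refine Or.inr ⟨⟨X₀, hX₀.trans (hmq X₀).1⟩, fun X hX => ?_⟩
          by_cases hmX : 1 ≤ m.1 X
          · obtain ⟨r, hr, hrX, hl⟩ := hm X hmX
            exact ⟨r, hr, hrX, (ih _ _ hl hmq.fire).mono (by omega)⟩
          · obtain ⟨r, hr, hrX⟩ := hR X
            have hm0 : m.1 r.1 = 0 := by rw [hrX]; omega
            refine ⟨r, hr, hrX, iht _ (hmq.skip hm0) ?_⟩
            rw [fire_snd_apply, if_neg (by rintro rfl; omega), if_pos (hX₀.trans (hmq X₀).1)]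
            omega
      exact key k q hmq (by omega)

theorem Safe.of_below (hR : ∀ X, ∃ r ∈ R, r.1 = X) (h : Safe R Φ k q) (hmq : Below m q) :
    Safe R Φ k m := fun N hN => by
  obtain ⟨N', hN'⟩ := exists_lose_of_below (Φ := Φ) (k := k) hR N
  exact h N' (hN' m q hN hmq)

theorem Safe.of_nil (h : Safe R Φ k q) : Safe R [] k q := by
  have key : ∀ N q, Lose R [] k N q → Lose R Φ k N q := by
    intro N
    induction N with
    | zero => exact fun q h => bad_of_nil h
    | succ N ih =>
      rintro q (h | ⟨hne, h⟩)
      · exact Or.inl (bad_of_nil h)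
      · refine Or.inr ⟨hne, fun X hX => ?_⟩
        obtain ⟨r, hr, hrX, hl⟩ := h X hX
        exact ⟨r, hr, hrX, ih _ hl⟩
  exact fun N hN => h N (key N q hN)

/-- If each action had a losing answer, the maximum of the finitely many losing bounds would make
`q` itself losing. This is the compactness that turns avoidance for every finite time into a move
that preserves safety. -/
theorem Safe.exists_action [Finite Γ] (h : Safe R Φ k q) (hq : ∃ X, 1 ≤ q.1 X) :
    ∃ X, 1 ≤ q.1 X ∧ ∀ r ∈ R, r.1 = X → Safe R Φ k (fire q r) := by
  have := Fintype.ofFinite Γ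
  by_contra! hcon
  have h' : ∀ X, ∃ N, 1 ≤ q.1 X → ∃ r ∈ R, r.1 = X ∧ Lose R Φ k N (fire q r) := by
    intro X
    by_cases hX : 1 ≤ q.1 X
    · obtain ⟨r, hr, hrX, hs⟩ := hcon X hX
      simp only [Safe, not_forall, not_not] at hs
      obtain ⟨N, hN⟩ := hs
      exact ⟨N, fun _ => ⟨r, hr, hrX, hN⟩⟩
    · exact ⟨0, fun h => absurd h hX⟩
  choose N hN using h'
  refine h (Finset.univ.sup N + 1) (Or.inr ⟨hq, fun X hX => ?_⟩)
  obtain ⟨r, hr, hrX, hl⟩ := hN X hX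
  exact ⟨r, hr, hrX, hl.mono (Finset.le_sup (Finset.mem_univ X))⟩

/-- The scheduler imitates a position of `I` lying above the current one and skips moves whose type
is missing. Passing to a larger member of `I` is harmless because badness is monotone. -/
theorem InductiveUpTo.safe (hR : ∀ X, ∃ r ∈ R, r.1 = X) {I : Set (Cfg Γ)}
    (hI : InductiveUpTo R Φ k I) (hq : q ∈ I) : Safe R Φ k q := by
  have key : ∀ N, ∀ z u, Below z u → u ∈ I → ¬ Lose R Φ k N z := by
    intro N
    induction N with
    | zero => exact fun z u hzu hu hz => (hI u hu).1 (Bad.mono hzu hz)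
    | succ N ih =>
      rintro z u hzu hu (hz | ⟨⟨X₀, hX₀⟩, hz⟩)
      · exact (hI u hu).1 (Bad.mono hzu hz)
      -- Inner induction on the remaining skips: `z` is fixed, and the waiting time of `X₀` in the
      -- imitated position grows with each skip, also after passing to a larger member of `I`.
      · have : ∀ t u, Below z u → u ∈ I → k ≤ u.2 X₀ + t → False := by
          intro t
          induction t with
          | zero =>
            exact fun u hzu hu ht => (hI u hu).1 (Or.inr ⟨X₀, hX₀.trans (hzu X₀).1, by omega⟩)
          | succ t iht =>
            intro u hzu hu ht
            have hu₀ := hX₀.trans (hzu X₀).1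
            rcases (hI u hu).2 with h0 | ⟨X, hX, hs⟩
            · have := h0 X₀
              omega
            · by_cases hzX : 1 ≤ z.1 X
              · obtain ⟨r, hr, hrX, hl⟩ := hz X hzX
                obtain ⟨p, hp, hbp⟩ := hs r hr hrX
                exact ih _ _ (hzu.fire.trans hbp) hp hl
              · obtain ⟨r, hr, hrX⟩ := hR X
                obtain ⟨p, hp, hbp⟩ := hs r hr hrX
                have hz0 : z.1 r.1 = 0 := by rw [hrX]; omega
                refine iht p ((hzu.skip hz0).trans hbp) hp ?_
                have hage : (FairGame.fire u r).2 X₀ = u.2 X₀ + 1 := by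
                  rw [fire_snd_apply, if_neg (by rintro rfl; omega), if_pos hu₀]
                have := (hbp X₀).2 (hX₀.trans ((hzu.skip hz0) X₀).1)
                omega
        exact this k u hzu hu (by omega)
  exact fun N => key N q q (Below.refl q) hq

/-- Configurations that are not safe lose within a uniform number of steps. -/
theorem exists_uniform_lose [Finite Γ] (hR : ∀ X, ∃ r ∈ R, r.1 = X) (Φ : List (Γ → ℕ)) (k : ℕ) :
    ∃ N, ∀ q, ¬ Safe R Φ k q → Lose R Φ k N q := by
  obtain ⟨M, hM⟩ := exists_basis (U := {q : Cfg Γ | ¬ Safe R Φ k q})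
    (fun a b hab ha hb => ha (hb.of_below hR (Below.of_le hab)))
  have h1 : ∀ m : Cfg Γ, ∃ N, ¬ Safe R Φ k m → Lose R Φ k N m := by
    intro m
    by_cases hm : Safe R Φ k m
    · exact ⟨0, fun h => absurd hm h⟩
    · obtain ⟨N, hN⟩ := not_forall_not.1 hm
      exact ⟨N, fun _ => hN⟩
  choose f hf using h1
  -- The maximum of the losing bounds of the finitely many basis elements, transported upward by
  -- monotonicity.
  obtain ⟨N', hN'⟩ := exists_lose_of_below (Φ := Φ) (k := k) hR ((M.map f).foldr max 0)
  refine ⟨N', fun q hq => ?_⟩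
  obtain ⟨m, hm, hmq⟩ := (hM q).1 hq
  refine hN' m q ((hf m ((hM m).2 ⟨m, hm, le_rfl⟩)).mono ?_) (Below.of_le hmq)
  exact List.le_max_of_le' 0 (List.mem_map_of_mem hm) le_rfl

/-- The smaller position follows the same path, omitting the steps that consume a token it lacks. -/
theorem CanReach.of_below (hR : ∀ X, ∃ r ∈ R, r.1 = X) (h : CanReach R Φ k q) :
    ∀ {m : Cfg Γ}, Below m q → CanReach R Φ k m := by
  induction h with
  | safe hs => exact fun hmq => .safe (hs.of_below hR hmq)
  | @step q r hb hr h1 hs _ ih =>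
    intro m hmq
    by_cases hm : 1 ≤ m.1 r.1
    · exact .step (fun h => hb (h.mono hmq)) hr hm
        (fun r' hr' he => (hs r' hr' he).of_below hR hmq.fire) (ih hmq.fire)
    · exact ih (hmq.skip (by omega))

end Game

end FairGame

/-! ### Finite certificates for the fairness game -/

namespace FairGame

/-- Replace numbers of tokens above `K` by `K`, which stands for arbitrarily many tokens. -/
def trunc {Γ : Type} (K : ℕ) (q : Cfg Γ) : Cfg Γ := (fun X => min (q.1 X) K, q.2)

theorem trunc_below {Γ : Type} (K : ℕ) (q : Cfg Γ) : Below (trunc K q) q := fun _ =>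
  ⟨min_le_left _ _, fun _ => le_rfl⟩

variable {Γ : Type} [DecidableEq Γ]

/-- Add a token to each type that has the maximal number `K` of tokens. -/
def bump (K : ℕ) (q : Cfg Γ) : Cfg Γ := (fun X => q.1 X + if q.1 X = K then 1 else 0, q.2)

/-- `L` is a set of truncated configurations in which the scheduler can remain, avoiding the bad
configurations. -/
def SafeCert (R : List (Γ × (Γ → ℕ))) (Φ : List (Γ → ℕ)) (k K : ℕ) (L : List (Cfg Γ)) : Prop :=
  0 < K ∧ ∀ u ∈ L, (∀ φ ∈ Φ, ∃ X, u.1 X < φ X ∧ u.1 X < K) ∧ ¬ (∃ X, 1 ≤ u.1 X ∧ k ≤ u.2 X) ∧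
    ((∀ X, u.1 X = 0) ∨
      ∃ X, 1 ≤ u.1 X ∧ ∀ r ∈ R, r.1 = X → trunc K (fire (bump K u) r) ∈ L)

/-- `D` is a derivation, ordered by the first components, that its members are not safe. -/
def LoseCert (R : List (Γ × (Γ → ℕ))) (Φ : List (Γ → ℕ)) (k : ℕ) (D : List (ℕ × Cfg Γ)) : Prop :=
  ∀ d ∈ D, Bad Φ k d.2 ∨ ((∃ X, 1 ≤ d.2.1 X) ∧ ∀ X, 1 ≤ d.2.1 X →
    ∃ r ∈ R, r.1 = X ∧ ∃ d' ∈ D, d'.1 < d.1 ∧ d'.2 = fire d.2 r)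

/-- `P` is a derivation, ordered by the first components, that its members satisfy `CanReach`. -/
def ReachCert (R : List (Γ × (Γ → ℕ))) (Φ : List (Γ → ℕ)) (k K₁ K₂ : ℕ) (L₁ L₂ : List (Cfg Γ))
    (P : List (ℕ × Cfg Γ)) : Prop :=
  ∀ p ∈ P, trunc K₁ p.2 ∈ L₁ ∨ (¬ Bad Φ k p.2 ∧ ∃ r ∈ R, 1 ≤ p.2.1 r.1 ∧
    (∀ r' ∈ R, r'.1 = r.1 → trunc K₂ (fire p.2 r') ∈ L₂) ∧
    ∃ p' ∈ P, p'.1 < p.1 ∧ p'.2 = fire p.2 r)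

/-- `T` generates an upward-closed set that is disjoint from `CanReach`. -/
def NotReachCert (R : List (Γ × (Γ → ℕ))) (Φ : List (Γ → ℕ)) (k : ℕ) (D₁ D₂ : List (ℕ × Cfg Γ))
    (T : List (Cfg Γ)) : Prop :=
  ∀ m ∈ T, Bad Φ k m ∨ ((∃ d ∈ D₁, d.2 = m) ∧ ∀ r ∈ R, 1 ≤ m.1 r.1 →
    (∃ r' ∈ R, r'.1 = r.1 ∧ ∃ d ∈ D₂, d.2 = fire m r') ∨ ∃ t ∈ T, t ≤ fire m r)

variable {R : List (Γ × (Γ → ℕ))} {Φ : List (Γ → ℕ)} {k : ℕ} {m q : Cfg Γ}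

/-- One extra token on saturated types compensates for the token that a rule consumes, so that `K`
keeps standing for arbitrarily many; without it a saturated type could fall to `K - 1`. -/
theorem trunc_fire_bump_trunc {K : ℕ} (hK : 0 < K) (q : Cfg Γ) (r : Γ × (Γ → ℕ)) :
    trunc K (fire (bump K (trunc K q)) r) =
      trunc K (fire (fun X => q.1 X + if K ≤ q.1 X then 1 else 0, q.2) r) := by
  ext X
  · simp only [trunc, bump, fire_fst_apply, min_eq_right_iff]
    split_ifs <;> omega
  · have h : 1 ≤ (bump K (trunc K q)).1 X ↔ 1 ≤ q.1 X + if K ≤ q.1 X then 1 else 0 := by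
      simp only [bump, trunc, min_eq_right_iff]
      split_ifs <;> omega
    change (fire (bump K (trunc K q)) r).2 X = (fire (_, q.2) r).2 X
    simp only [fire_snd_apply, h]
    rfl

/-- The positions with truncation in `L` are inductive up to simulation: the actual successor lies
below the successor with extra tokens, whose truncation is in `L`. The clause `u.1 X < K` guarantees
that truncation did not alter the coordinate witnessing that `φ` is not covered. -/
theorem SafeCert.safe (hR : ∀ X, ∃ r ∈ R, r.1 = X) {K : ℕ} {L : List (Cfg Γ)}
    (hL : SafeCert R Φ k K L) (hq : trunc K q ∈ L) : Safe R Φ k q := by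
  obtain ⟨hK, hL⟩ := hL
  refine InductiveUpTo.safe hR (I := {q | trunc K q ∈ L}) (fun q hq => ?_) hq
  obtain ⟨h1, h2, h3⟩ := hL _ hq
  refine ⟨?_, ?_⟩
  · rintro (⟨φ, hφ, hle⟩ | ⟨X, hX, hk⟩)
    · obtain ⟨X, hX, hXK⟩ := h1 φ hφ
      have : φ X ≤ q.1 X := hle X
      simp only [trunc] at hX hXK
      omega
    · exact h2 ⟨X, by simp only [trunc]; omega, hk⟩
  · rcases h3 with h0 | ⟨X, hX, hs⟩
    · refine Or.inl fun X => ?_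
      have := h0 X
      simp only [trunc] at this
      omega
    · simp only [trunc] at hX
      refine Or.inr ⟨X, by omega, fun r hr hrX => ?_⟩
      refine ⟨fire (fun X => q.1 X + if K ≤ q.1 X then 1 else 0, q.2) r, ?_, Below.fire ?_⟩
      · rw [Set.mem_ofPred_eq, ← trunc_fire_bump_trunc hK]
        exact hs r hr hrX
      · exact fun X => ⟨by simp, fun _ => le_rfl⟩

/-- With `K` above all token numbers in a basis of the non-safe positions, tokens beyond `K` do not
affect safety. So the safe positions with at most `K` tokens per type and bounded waiting times form
a certificate. -/
theorem exists_safeCert [Finite Γ] (hR : ∀ X, ∃ r ∈ R, r.1 = X) (Φ : List (Γ → ℕ)) (k C : ℕ) :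
    ∃ K L, SafeCert R Φ k K L ∧ ∀ q, Safe R Φ k q → (∀ X, q.2 X ≤ C) → trunc K q ∈ L := by
  classical
  have := Fintype.ofFinite Γ
  obtain ⟨M, hM⟩ := exists_basis (U := {q : Cfg Γ | ¬ Safe R Φ k q})
    (fun a b hab ha hb => ha (hb.of_below hR (Below.of_le hab)))
  obtain ⟨K, hK, hKM, hKΦ⟩ : ∃ K, 0 < K ∧ (∀ m ∈ M, ∀ X, m.1 X ≤ K) ∧ ∀ φ ∈ Φ, ∀ X, φ X ≤ K := by
    refine ⟨1 + ((M.map fun m => Finset.univ.sup m.1).foldr max 0 +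
      (Φ.map fun φ => Finset.univ.sup φ).foldr max 0), by omega, fun m hm X => ?_, fun φ hφ X => ?_⟩
    · have h1 : Finset.univ.sup m.1 ≤ (M.map fun m => Finset.univ.sup m.1).foldr max 0 :=
        List.le_max_of_le' 0 (List.mem_map_of_mem hm) le_rfl
      have h2 : m.1 X ≤ Finset.univ.sup m.1 := Finset.le_sup (Finset.mem_univ X)
      omega
    · have h1 : Finset.univ.sup φ ≤ (Φ.map fun φ => Finset.univ.sup φ).foldr max 0 :=
        List.le_max_of_le' 0 (List.mem_map_of_mem hφ) le_rfl
      have h2 : φ X ≤ Finset.univ.sup φ := Finset.le_sup (Finset.mem_univ X)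
      omega
  -- Waiting times start at most `C`; a present type in a safe position has waited less than `k`, so
  -- the next value is at most `k`.
  have hfin : {q : Cfg Γ | (q.1 ≤ fun _ => K) ∧ (q.2 ≤ fun _ => max C k) ∧ Safe R Φ k q}.Finite :=
    ((Set.finite_Iic (fun _ : Γ => K)).prod (Set.finite_Iic (fun _ : Γ => max C k))).subset
      (fun q hq => ⟨hq.1, hq.2.1⟩)
  refine ⟨K, hfin.toFinset.toList, ⟨hK, fun u hu => ?_⟩, fun q hq hC => ?_⟩
  · simp only [Finset.mem_toList, Set.Finite.mem_toFinset, Set.mem_ofPred_eq] at hu ⊢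
    obtain ⟨huK, huC, hu⟩ := hu
    have htb : trunc K (bump K u) = u := by
      ext X
      · have : u.1 X ≤ K := huK X
        simp only [trunc, bump]
        split_ifs <;> omega
      · rfl
    -- A basis element below `bump K u` has at most `K` tokens of each type, so it already lies
    -- below `u`.
    have hbs : Safe R Φ k (bump K u) := by
      by_contra hns
      obtain ⟨m, hm, hmu⟩ := (hM _).1 hns
      refine (hM u).2 ⟨m, hm, ?_⟩ hu
      rw [← htb]
      exact ⟨fun X => le_min (hmu.1 X) (hKM m hm X), hmu.2⟩
    refine ⟨fun φ hφ => ?_, fun h => hu.not_bad (Or.inr h), ?_⟩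
    · by_contra! hcon
      refine hu.not_bad (Or.inl ⟨φ, hφ, fun X => ?_⟩)
      by_contra hle
      have hlt : u.1 X < φ X := not_le.1 hle
      have h1 := hcon X hlt
      have h2 := hKΦ φ hφ X
      omega
    · by_cases h0 : ∀ X, u.1 X = 0
      · exact Or.inl h0
      · push Not at h0
        obtain ⟨X₀, hX₀⟩ := h0
        obtain ⟨X, hX, hs⟩ := hbs.exists_action ⟨X₀, by simp only [bump]; omega⟩
        have hX' : 1 ≤ u.1 X := by
          simp only [bump] at hX
          split_ifs at hX <;> omega
        refine Or.inr ⟨X, hX', fun r hr hrX => ⟨fun X => min_le_right _ _, fun Y => ?_,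
          (hs r hr hrX).of_below hR (trunc_below _ _)⟩⟩
        have h1 := huC Y
        have h2 : ¬ (1 ≤ (bump K u).1 Y ∧ k ≤ u.2 Y) := fun h => hbs.not_bad (Or.inr ⟨Y, h⟩)
        simp only [trunc, fire_snd_apply]
        have : (bump K u).2 Y = u.2 Y := rfl
        split_ifs <;> omega
  · simp only [Finset.mem_toList, Set.Finite.mem_toFinset, Set.mem_ofPred_eq]
    exact ⟨fun X => min_le_right _ _, fun X => (hC X).trans (le_max_left _ _),
      hq.of_below hR (trunc_below _ _)⟩

theorem LoseCert.not_safe {D : List (ℕ × Cfg Γ)} (hD : LoseCert R Φ k D) :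
    ∀ {d : ℕ × Cfg Γ}, d ∈ D → ¬ Safe R Φ k d.2 := by
  have key : ∀ N, ∀ d ∈ D, d.1 < N → Lose R Φ k N d.2 := by
    intro N
    induction N with
    | zero => intro d _ h; omega
    | succ N ih =>
      intro d hd hdN
      rcases hD d hd with h | ⟨hne, h⟩
      · exact Or.inl h
      · refine Or.inr ⟨hne, fun X hX => ?_⟩
        obtain ⟨r, hr, hrX, d', hd', hlt, he⟩ := h X hX
        exact ⟨r, hr, hrX, he ▸ ih d' hd' (by omega)⟩
  exact fun {d} hd hs => hs _ (key (d.1 + 1) d hd (Nat.lt_succ_self _))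

theorem LoseCert.append {D D' : List (ℕ × Cfg Γ)} (hD : LoseCert R Φ k D)
    (hD' : LoseCert R Φ k D') : LoseCert R Φ k (D ++ D') := by
  intro d hd
  rcases List.mem_append.1 hd with hd | hd
  · refine (hD d hd).imp_right fun ⟨hne, h⟩ => ⟨hne, fun X hX => ?_⟩
    obtain ⟨r, hr, hrX, d', hd', h⟩ := h X hX
    exact ⟨r, hr, hrX, d', List.mem_append_left _ hd', h⟩
  · refine (hD' d hd).imp_right fun ⟨hne, h⟩ => ⟨hne, fun X hX => ?_⟩
    obtain ⟨r, hr, hrX, d', hd', h⟩ := h X hX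
    exact ⟨r, hr, hrX, d', List.mem_append_right _ hd', h⟩

theorem LoseCert.exists_forall {ι : Type*} {l : List ι} {f : ι → ℕ × Cfg Γ}
    (h : ∀ i ∈ l, ∃ D, LoseCert R Φ k D ∧ f i ∈ D) :
    ∃ D, LoseCert R Φ k D ∧ ∀ i ∈ l, f i ∈ D := by
  induction l with
  | nil => exact ⟨[], by simp [LoseCert], by simp⟩
  | cons i l ih =>
    obtain ⟨D, hD, hl⟩ := ih fun j hj => h j (List.mem_cons_of_mem _ hj)
    obtain ⟨D', hD', hi⟩ := h i List.mem_cons_self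
    refine ⟨D' ++ D, hD'.append hD, fun j hj => ?_⟩
    rcases List.mem_cons.1 hj with rfl | hj
    · exact List.mem_append_left _ hi
    · exact List.mem_append_right _ (hl j hj)

theorem Lose.exists_cert [Finite Γ] {N : ℕ} (h : Lose R Φ k N q) :
    ∃ D, LoseCert R Φ k D ∧ (N, q) ∈ D := by
  have := Fintype.ofFinite Γ
  induction N generalizing q with
  | zero => exact ⟨[(0, q)], fun d hd => by rw [List.mem_singleton.1 hd]; exact Or.inl h, by simp⟩
  | succ N ih =>
    rcases h with h | ⟨⟨X₀, hX₀⟩, h⟩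
    · exact ⟨[(N + 1, q)], fun d hd => by rw [List.mem_singleton.1 hd]; exact Or.inl h, by simp⟩
    · choose! f hf hfX hfl using h
      obtain ⟨D, hD, hDl⟩ := LoseCert.exists_forall (R := R) (Φ := Φ) (k := k)
        (l := (Finset.univ.filter fun X => 1 ≤ q.1 X).toList) (f := fun X => (N, fire q (f X)))
        (fun X hX => ih (hfl X (by simpa using hX)))
      refine ⟨[(N + 1, q)] ++ D, ?_, by simp⟩
      intro d hd
      rcases List.mem_append.1 hd with hd | hd
      · rw [List.mem_singleton.1 hd]
        refine Or.inr ⟨⟨X₀, hX₀⟩, fun X hX => ⟨f X, hf X hX, hfX X hX, (N, fire q (f X)),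
          List.mem_append_right _ (hDl X (by simpa using hX)), Nat.lt_succ_self N, rfl⟩⟩
      · refine (hD d hd).imp_right fun ⟨hne, h⟩ => ⟨hne, fun X hX => ?_⟩
        obtain ⟨r, hr, hrX, d', hd', h⟩ := h X hX
        exact ⟨r, hr, hrX, d', List.mem_append_right _ hd', h⟩

theorem exists_loseCert_forall [Finite Γ] {l : List (Cfg Γ)} (h : ∀ q ∈ l, ¬ Safe R Φ k q) :
    ∃ D, LoseCert R Φ k D ∧ ∀ q ∈ l, ∃ d ∈ D, d.2 = q := by
  have h' : ∀ q, ∃ N, q ∈ l → Lose R Φ k N q := fun q => by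
    by_cases hq : q ∈ l
    · obtain ⟨N, hN⟩ := not_forall_not.1 (h q hq)
      exact ⟨N, fun _ => hN⟩
    · exact ⟨0, fun h => absurd h hq⟩
  choose f hf using h'
  obtain ⟨D, hD, hl⟩ := LoseCert.exists_forall (R := R) (Φ := Φ) (k := k)
    (l := l) (f := fun q => (f q, q)) (fun q hq => (hf q hq).exists_cert)
  exact ⟨D, hD, fun q hq => ⟨_, hl q hq, rfl⟩⟩

theorem ReachCert.canReach (hR : ∀ X, ∃ r ∈ R, r.1 = X) {K₁ K₂ : ℕ} {L₁ L₂ : List (Cfg Γ)}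
    {P : List (ℕ × Cfg Γ)} (h₁ : SafeCert R Φ k K₁ L₁) (h₂ : SafeCert R [] k K₂ L₂)
    (hP : ReachCert R Φ k K₁ K₂ L₁ L₂ P) :
    ∀ {p : ℕ × Cfg Γ}, p ∈ P → CanReach R Φ k p.2 := by
  have key : ∀ N, ∀ p ∈ P, p.1 < N → CanReach R Φ k p.2 := by
    intro N
    induction N with
    | zero => intro d _ h; omega
    | succ N ih =>
      intro p hp hpN
      rcases hP p hp with h | ⟨hb, r, hr, hr1, hs, p', hp', hlt, he⟩
      · exact .safe (h₁.safe hR h)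
      · exact .step hb hr hr1 (fun r' hr' hX => h₂.safe hR (hs r' hr' hX))
          (he ▸ ih p' hp' (by omega))
  exact fun {p} hp => key _ p hp (Nat.lt_succ_self _)

/-- Every position left by a move is not bad, so its present types have waited less than `k`; hence
waiting times stay at most `C` and the truncation certificates apply along the whole path. -/
theorem CanReach.exists_reachCert {C : ℕ} {K₁ K₂ : ℕ} {L₁ L₂ : List (Cfg Γ)}
    (h₁ : ∀ q, Safe R Φ k q → (∀ X, q.2 X ≤ C) → trunc K₁ q ∈ L₁)
    (h₂ : ∀ q, Safe R [] k q → (∀ X, q.2 X ≤ C) → trunc K₂ q ∈ L₂) (hkC : k ≤ C)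
    (h : CanReach R Φ k q) (hq : ∀ X, q.2 X ≤ C) :
    ∃ N P, ReachCert R Φ k K₁ K₂ L₁ L₂ P ∧ (N, q) ∈ P := by
  induction h with
  | @safe q hs =>
    refine ⟨0, [(0, q)], fun p hp => ?_, by simp⟩
    rw [List.mem_singleton.1 hp]
    exact Or.inl (h₁ q hs hq)
  | @step q r hb hr h1 hs _ ih =>
    have hage : ∀ r' X, (fire q r').2 X ≤ C := fun r' X => by
      have h2 : ¬ (1 ≤ q.1 X ∧ k ≤ q.2 X) := fun h => hb (Or.inr ⟨X, h⟩)
      rw [fire_snd_apply]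
      split_ifs <;> omega
    obtain ⟨N, P, hP, hmem⟩ := ih (hage r)
    refine ⟨N + 1, [(N + 1, q)] ++ P, fun p hp => ?_, by simp⟩
    rcases List.mem_append.1 hp with hp | hp
    · rw [List.mem_singleton.1 hp]
      exact Or.inr ⟨hb, r, hr, h1, fun r' hr' he => h₂ _ (hs r' hr' he) (hage r'),
        (N, fire q r), List.mem_append_right _ hmem, Nat.lt_succ_self N, rfl⟩
    · refine (hP p hp).imp_right fun ⟨hb, r, hr, h1, hs, p', hp', h⟩ =>
        ⟨hb, r, hr, h1, hs, p', List.mem_append_right _ hp', h⟩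

/-- Certificates that `CanReach` holds. -/
theorem canReach_iff_exists_cert [Finite Γ] (hR : ∀ X, ∃ r ∈ R, r.1 = X) (α : Γ → ℕ) :
    CanReach R Φ k (α, fun _ => 0) ↔ ∃ K₁ K₂ L₁ L₂ P, SafeCert R Φ k K₁ L₁ ∧
      SafeCert R [] k K₂ L₂ ∧ ReachCert R Φ k K₁ K₂ L₁ L₂ P ∧
      ∃ p ∈ P, p.2 = (α, fun _ => 0) := by
  constructor
  · intro h
    obtain ⟨K₁, L₁, hc₁, h₁⟩ := exists_safeCert hR Φ k k
    obtain ⟨K₂, L₂, hc₂, h₂⟩ := exists_safeCert hR [] k k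
    obtain ⟨N, P, hP, hmem⟩ := h.exists_reachCert h₁ h₂ le_rfl (fun _ => Nat.zero_le _)
    exact ⟨K₁, K₂, L₁, L₂, P, hc₁, hc₂, hP, _, hmem, rfl⟩
  · rintro ⟨K₁, K₂, L₁, L₂, P, hc₁, hc₂, hP, p, hp, he⟩
    exact he ▸ ReachCert.canReach hR hc₁ hc₂ hP hp

/-- Along a `CanReach` path starting above `T`, each move either is skipped by the element of `T` or
leads above another one. A safe end is excluded by `D₁`, and a move with an outcome unsafe for
fairness by `D₂`. -/
theorem NotReachCert.not_canReach (hR : ∀ X, ∃ r ∈ R, r.1 = X) {D₁ D₂ : List (ℕ × Cfg Γ)}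
    {T : List (Cfg Γ)} (h₁ : LoseCert R Φ k D₁) (h₂ : LoseCert R [] k D₂)
    (hT : NotReachCert R Φ k D₁ D₂ T) (h : CanReach R Φ k q) :
    ∀ m ∈ T, ¬ Below m q := by
  induction h with
  | safe hs =>
    intro m hm hmq
    rcases hT m hm with hb | ⟨⟨d, hd, rfl⟩, -⟩
    · exact hs.not_bad (hb.mono hmq)
    · exact h₁.not_safe hd (hs.of_below hR hmq)
  | @step q r hb hr h1 hs _ ih =>
    intro m hm hmq
    by_cases hmr : 1 ≤ m.1 r.1
    · rcases hT m hm with hbm | ⟨-, hstep⟩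
      · exact hb (hbm.mono hmq)
      · rcases hstep r hr hmr with ⟨r', hr', he, d, hd, hdf⟩ | ⟨t, ht, hle⟩
        · exact h₂.not_safe hd (hdf ▸ (hs r' hr' he).of_below hR hmq.fire)
        · exact ih t ht ((Below.of_le hle).trans hmq.fire)
    · exact ih m hm (hmq.skip (by omega))

/-- Certificates that `CanReach` fails. -/
theorem not_canReach_iff_exists_cert [Finite Γ] (hR : ∀ X, ∃ r ∈ R, r.1 = X) (q : Cfg Γ) :
    ¬ CanReach R Φ k q ↔ ∃ D₁ D₂ T, LoseCert R Φ k D₁ ∧ LoseCert R [] k D₂ ∧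
      NotReachCert R Φ k D₁ D₂ T ∧ ∃ t ∈ T, t ≤ q := by
  classical
  constructor
  · intro h
    obtain ⟨T, hT⟩ := exists_basis (U := {q : Cfg Γ | ¬ CanReach R Φ k q})
      (fun a b hab ha hb => ha (hb.of_below hR (Below.of_le hab)))
    have hT' : ∀ m ∈ T, ¬ CanReach R Φ k m := fun m hm => (hT m).2 ⟨m, hm, le_rfl⟩
    obtain ⟨D₁, hD₁, h₁⟩ := exists_loseCert_forall (R := R) (Φ := Φ) (k := k) (l := T)
      (fun m hm hs => hT' m hm (.safe hs))
    -- Only the finitely many one-step successors of basis elements can obstruct the fairness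
    -- condition, so one derivation covers all of them.
    obtain ⟨D₂, hD₂, h₂⟩ := exists_loseCert_forall (R := R) (Φ := []) (k := k)
      (l := (T.flatMap fun m => R.map (fire m)).filter fun q => ¬ Safe R [] k q)
      (fun q hq => by simpa using (List.mem_filter.1 hq).2)
    refine ⟨D₁, D₂, T, hD₁, hD₂, fun m hm => ?_, (hT q).1 h⟩
    by_cases hb : Bad Φ k m
    · exact Or.inl hb
    · refine Or.inr ⟨h₁ m hm, fun r hr hmr => ?_⟩
      by_cases hs : ∀ r' ∈ R, r'.1 = r.1 → Safe R [] k (fire m r')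
      · exact Or.inr ((hT _).1 fun hreach => hT' m hm (.step hb hr hmr hs hreach))
      · push Not at hs
        obtain ⟨r', hr', he, hns⟩ := hs
        refine Or.inl ⟨r', hr', he, h₂ _ (List.mem_filter.2 ⟨?_, by simpa using hns⟩)⟩
        exact List.mem_flatMap.2 ⟨m, hm, List.mem_map_of_mem hr'⟩
  · rintro ⟨D₁, D₂, T, h₁, h₂, hT, t, ht, hle⟩ h
    exact hT.not_canReach hR h₁ h₂ h t ht (Below.of_le hle)

end FairGame

/-! ### Checking certificates is primitive recursive -/

namespace PrimrecPred

variable {α β : Type*} [Primcodable α] [Primcodable β]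

theorem imp {p q : α → Prop} (hp : PrimrecPred p) (hq : PrimrecPred q) :
    PrimrecPred fun a => p a → q a :=
  (hp.not.or hq).of_eq fun _ => by tauto

theorem exists_mem {f : α → List β} {P : α → β → Prop} (hf : Primrec f)
    (hP : PrimrecPred fun x : α × β => P x.1 x.2) : PrimrecPred fun a => ∃ b ∈ f a, P a b :=
  (PrimrecRel.exists_mem_list (R := fun b a => P a b)
    (hP.comp (Primrec.snd.pair Primrec.fst))).comp hf Primrec.id

theorem forall_mem {f : α → List β} {P : α → β → Prop} (hf : Primrec f)
    (hP : PrimrecPred fun x : α × β => P x.1 x.2) : PrimrecPred fun a => ∀ b ∈ f a, P a b :=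
  (PrimrecRel.forall_mem_list (R := fun b a => P a b)
    (hP.comp (Primrec.snd.pair Primrec.fst))).comp hf Primrec.id

theorem exists_lt_of {f : α → ℕ} {P : α → ℕ → Prop} (hf : Primrec f)
    (hP : PrimrecPred fun x : α × ℕ => P x.1 x.2) : PrimrecPred fun a => ∃ b < f a, P a b :=
  (exists_mem (Primrec.list_range.comp hf) hP).of_eq fun _ => by simp

theorem forall_lt_of {f : α → ℕ} {P : α → ℕ → Prop} (hf : Primrec f)
    (hP : PrimrecPred fun x : α × ℕ => P x.1 x.2) : PrimrecPred fun a => ∀ b < f a, P a b :=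
  (forall_mem (Primrec.list_range.comp hf) hP).of_eq fun _ => by simp

end PrimrecPred

/-- Two complementary searches for certificates decide which of them succeeds. -/
theorem exists_computable_of_certificates {α β γ : Type*} [Primcodable α] [Primcodable β]
    [Primcodable γ] {p : α → β → Prop} {q : α → γ → Prop}
    (hp : PrimrecPred fun x : α × β => p x.1 x.2) (hq : PrimrecPred fun x : α × γ => q x.1 x.2)
    (h : ∀ a, (∃ b, p a b) ∨ ∃ c, q a c) :
    ∃ f : α → Bool, Computable f ∧
      ∀ a, (f a = true → ∃ b, p a b) ∧ (f a = false → ∃ c, q a c) := by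
  classical
  -- The number `n` is tried as a code of a certificate of either kind; the first success in an
  -- unbounded search gives the answer.
  let g : α → ℕ → Option Bool := fun a n =>
    ((Encodable.decode n : Option β).bind fun b => if p a b then some true else none) <|>
      ((Encodable.decode n : Option γ).bind fun c => if q a c then some false else none)
  have hg : Primrec₂ g := by
    refine Primrec.option_orElse.comp ?_ ?_
    · refine Primrec.option_bind (Primrec.decode.comp Primrec.snd) ?_
      refine Primrec.ite ?_ (Primrec.const _) (Primrec.const _)
      exact hp.comp ((Primrec.fst.comp Primrec.fst).pair Primrec.snd)
    · refine Primrec.option_bind (Primrec.decode.comp Primrec.snd) ?_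
      refine Primrec.ite ?_ (Primrec.const _) (Primrec.const _)
      exact hq.comp ((Primrec.fst.comp Primrec.fst).pair Primrec.snd)
  have hdom : ∀ a, (Nat.rfindOpt (g a)).Dom := by
    intro a
    rw [Nat.rfindOpt_dom]
    rcases h a with ⟨b, hb⟩ | ⟨c, hc⟩
    · exact ⟨Encodable.encode b, true, by simp [g, Encodable.encodek, hb]⟩
    · refine ⟨Encodable.encode c, ?_⟩
      simp only [g, Encodable.encodek, Option.bind_some, if_pos hc]
      cases (Encodable.decode (Encodable.encode c) : Option β).bind
        fun b => if p a b then some true else none with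
      | none => exact ⟨false, by simp⟩
      | some x => exact ⟨x, by simp⟩
  refine ⟨fun a => (Nat.rfindOpt (g a)).get (hdom a),
    (Partrec.rfindOpt hg.to_comp).of_eq_tot fun a => Part.get_mem _, fun a => ?_⟩
  obtain ⟨n, hn⟩ := Nat.rfindOpt_spec (Part.get_mem (hdom a))
  have key : ∀ x, x ∈ g a n → (x = true → ∃ b, p a b) ∧ (x = false → ∃ c, q a c) := by
    intro x hx
    simp only [g, Option.mem_def, Option.orElse_eq_some] at hx
    rcases hx with hx | ⟨-, hx⟩
    · obtain ⟨b, -, hb⟩ := Option.bind_eq_some_iff.1 hx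
      split_ifs at hb with hpb
      obtain rfl := Option.some.inj hb
      exact ⟨fun _ => ⟨b, hpb⟩, by simp⟩
    · obtain ⟨c, -, hc⟩ := Option.bind_eq_some_iff.1 hx
      split_ifs at hc with hqc
      obtain rfl := Option.some.inj hc
      exact ⟨by simp, fun _ => ⟨c, hqc⟩⟩
  exact key _ hn

/-! ### Certificates as lists of natural numbers -/

namespace FairGame

/-- The code of a rule: its left-hand side, its right-hand side, and its probability. -/
abbrev RuleCode : Type := ℕ × List ℕ × ℕ × ℕ

/-- The code of a configuration with waiting times. -/
abbrev CfgCode : Type := List ℕ × List ℕ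

/-- The vector of length `n` with code `l`. -/
def vec (n : ℕ) (l : List ℕ) : Fin n → ℕ := fun i => l.getD i 0

/-- The configuration with waiting times that has code `s`. -/
def cfg (n : ℕ) (s : CfgCode) : Cfg (Fin n) := (vec n s.1, vec n s.2)

/-- The list of rules with codes `l`. -/
def rulesOf (n : ℕ) (l : List RuleCode) : List (Fin n × (Fin n → ℕ)) :=
  l.filterMap fun e => if h : e.1 < n then some (⟨e.1, h⟩, vec n e.2.1) else none

/-- The pair of a rank and a configuration that has code `d`. -/
def rankedCfg (n : ℕ) (d : ℕ × CfgCode) : ℕ × Cfg (Fin n) := (d.1, cfg n d.2)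

/-- Equality of the configurations with codes `s` and `t`. -/
def EqCode (n : ℕ) (s t : CfgCode) : Prop :=
  ∀ i < n, s.1.getD i 0 = t.1.getD i 0 ∧ s.2.getD i 0 = t.2.getD i 0

/-- The order on the configurations with codes `s` and `t`. -/
def LeCode (n : ℕ) (s t : CfgCode) : Prop :=
  ∀ i < n, s.1.getD i 0 ≤ t.1.getD i 0 ∧ s.2.getD i 0 ≤ t.2.getD i 0

def fireCode (n : ℕ) (s : CfgCode) (e : RuleCode) : CfgCode :=
  ((List.range n).map fun i => s.1.getD i 0 - (if i = e.1 then 1 else 0) + e.2.1.getD i 0,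
    (List.range n).map fun i =>
      if e.1 = i then 0 else if 1 ≤ s.1.getD i 0 then s.2.getD i 0 + 1 else 0)

def truncCode (n K : ℕ) (s : CfgCode) : CfgCode :=
  ((List.range n).map fun i => min (s.1.getD i 0) K, s.2)

def bumpCode (n K : ℕ) (s : CfgCode) : CfgCode :=
  ((List.range n).map fun i => s.1.getD i 0 + if s.1.getD i 0 = K then 1 else 0, s.2)

def BadCode (n : ℕ) (Φ : List (List ℕ)) (k : ℕ) (s : CfgCode) : Prop :=
  (∃ φ ∈ Φ, ∀ i < n, φ.getD i 0 ≤ s.1.getD i 0) ∨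
    ∃ i < n, 1 ≤ s.1.getD i 0 ∧ k ≤ s.2.getD i 0

def SafeCertCode (n : ℕ) (R : List RuleCode) (Φ : List (List ℕ)) (k K : ℕ) (L : List CfgCode) :
    Prop :=
  0 < K ∧ ∀ u ∈ L, (∀ φ ∈ Φ, ∃ i < n, u.1.getD i 0 < φ.getD i 0 ∧ u.1.getD i 0 < K) ∧
    (¬ ∃ i < n, 1 ≤ u.1.getD i 0 ∧ k ≤ u.2.getD i 0) ∧ ((∀ i < n, u.1.getD i 0 = 0) ∨
      ∃ i < n, 1 ≤ u.1.getD i 0 ∧ ∀ e ∈ R, e.1 = i →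
        ∃ v ∈ L, EqCode n v (truncCode n K (fireCode n (bumpCode n K u) e)))

def LoseCertCode (n : ℕ) (R : List RuleCode) (Φ : List (List ℕ)) (k : ℕ)
    (D : List (ℕ × CfgCode)) : Prop :=
  ∀ d ∈ D, BadCode n Φ k d.2 ∨ ((∃ i < n, 1 ≤ d.2.1.getD i 0) ∧ ∀ i < n, 1 ≤ d.2.1.getD i 0 →
    ∃ e ∈ R, e.1 = i ∧ ∃ d' ∈ D, d'.1 < d.1 ∧ EqCode n d'.2 (fireCode n d.2 e))

def ReachCertCode (n : ℕ) (R : List RuleCode) (Φ : List (List ℕ)) (k K₁ K₂ : ℕ)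
    (L₁ L₂ : List CfgCode) (P : List (ℕ × CfgCode)) : Prop :=
  ∀ p ∈ P, (∃ v ∈ L₁, EqCode n v (truncCode n K₁ p.2)) ∨ (¬ BadCode n Φ k p.2 ∧
    ∃ e ∈ R, e.1 < n ∧ 1 ≤ p.2.1.getD e.1 0 ∧
      (∀ e' ∈ R, e'.1 = e.1 → ∃ v ∈ L₂, EqCode n v (truncCode n K₂ (fireCode n p.2 e'))) ∧
      ∃ p' ∈ P, p'.1 < p.1 ∧ EqCode n p'.2 (fireCode n p.2 e))

def NotReachCertCode (n : ℕ) (R : List RuleCode) (Φ : List (List ℕ)) (k : ℕ)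
    (D₁ D₂ : List (ℕ × CfgCode)) (T : List CfgCode) : Prop :=
  ∀ m ∈ T, BadCode n Φ k m ∨ ((∃ d ∈ D₁, EqCode n d.2 m) ∧
    ∀ e ∈ R, e.1 < n → 1 ≤ m.1.getD e.1 0 →
      (∃ e' ∈ R, e'.1 = e.1 ∧ ∃ d ∈ D₂, EqCode n d.2 (fireCode n m e')) ∨
        ∃ t ∈ T, LeCode n t (fireCode n m e))

section Correct

variable {n : ℕ}

theorem vec_ofFn (α : Fin n → ℕ) : vec n (List.ofFn α) = α := by
  ext i
  simp [vec]

theorem vec_map_range (f : ℕ → ℕ) : vec n ((List.range n).map f) = fun i : Fin n => f i := by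
  ext i
  simp [vec]

theorem vec_apply (l : List ℕ) (i : Fin n) : vec n l i = l.getD i 0 := rfl

/-- This allows quantifiers over certificates to be replaced by quantifiers over their codes. -/
theorem cfg_surjective : Function.Surjective (cfg n) := fun q =>
  ⟨(List.ofFn q.1, List.ofFn q.2), by simp [cfg, vec_ofFn]⟩

theorem rankedCfg_surjective : Function.Surjective (rankedCfg n) := fun d => by
  obtain ⟨s, hs⟩ := cfg_surjective d.2
  exact ⟨(d.1, s), by simp [rankedCfg, hs]⟩

theorem exists_mem_rulesOf {R : List RuleCode} {P : Fin n × (Fin n → ℕ) → Prop} :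
    (∃ r ∈ rulesOf n R, P r) ↔ ∃ e ∈ R, ∃ h : e.1 < n, P (⟨e.1, h⟩, vec n e.2.1) := by
  simp only [rulesOf, List.mem_filterMap]
  constructor
  · rintro ⟨r, ⟨e, he, her⟩, hP⟩
    split_ifs at her with h
    obtain rfl := Option.some.inj her
    exact ⟨e, he, h, hP⟩
  · rintro ⟨e, he, h, hP⟩
    exact ⟨_, ⟨e, he, dif_pos h⟩, hP⟩

theorem forall_mem_rulesOf {R : List RuleCode} {P : Fin n × (Fin n → ℕ) → Prop} :
    (∀ r ∈ rulesOf n R, P r) ↔ ∀ e ∈ R, ∀ h : e.1 < n, P (⟨e.1, h⟩, vec n e.2.1) := by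
  have := exists_mem_rulesOf (n := n) (R := R) (P := fun r => ¬ P r)
  rw [← not_iff_not]
  push Not
  exact this

theorem eqCode_iff {s t : CfgCode} : EqCode n s t ↔ cfg n s = cfg n t := by
  simp [EqCode, cfg, funext_iff, Fin.forall_iff, vec_apply, forall_and]

theorem leCode_iff {s t : CfgCode} : LeCode n s t ↔ cfg n s ≤ cfg n t := by
  simp [LeCode, cfg, Prod.le_def, Pi.le_def, Fin.forall_iff, vec_apply, forall_and]

theorem cfg_fireCode (s : CfgCode) {e : RuleCode} (h : e.1 < n) :
    cfg n (fireCode n s e) = fire (cfg n s) (⟨e.1, h⟩, vec n e.2.1) := by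
  ext i
  · simp [cfg, fireCode, vec_map_range, fire_fst_apply, vec_apply, Fin.ext_iff]
  · simp [cfg, fireCode, vec_map_range, fire_snd_apply, vec_apply, Fin.ext_iff]

theorem cfg_truncCode (K : ℕ) (s : CfgCode) : cfg n (truncCode n K s) = trunc K (cfg n s) := by
  simp [cfg, truncCode, vec_map_range, trunc, vec_apply]

theorem cfg_bumpCode (K : ℕ) (s : CfgCode) : cfg n (bumpCode n K s) = bump K (cfg n s) := by
  simp [cfg, bumpCode, vec_map_range, bump, vec_apply]

theorem _root_.List.exists_mem_map {α β : Type*} {f : α → β} {l : List α} {P : β → Prop} :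
    (∃ b ∈ l.map f, P b) ↔ ∃ a ∈ l, P (f a) := by simp

theorem cfg_fst_mk (s : CfgCode) {i : ℕ} (h : i < n) : (cfg n s).1 ⟨i, h⟩ = s.1.getD i 0 := rfl

theorem cfg_snd_mk (s : CfgCode) {i : ℕ} (h : i < n) : (cfg n s).2 ⟨i, h⟩ = s.2.getD i 0 := rfl

theorem vec_mk (l : List ℕ) {i : ℕ} (h : i < n) : vec n l ⟨i, h⟩ = l.getD i 0 := rfl

theorem badCode_iff {Φ : List (List ℕ)} {k : ℕ} {s : CfgCode} :
    BadCode n Φ k s ↔ Bad (Φ.map (vec n)) k (cfg n s) := by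
  simp only [BadCode, Bad, List.exists_mem_map, Pi.le_def, Fin.forall_iff, Fin.exists_iff, vec_mk,
    cfg_fst_mk, cfg_snd_mk, exists_prop]

theorem exists_eqCode_iff {L : List CfgCode} {s : CfgCode} :
    (∃ v ∈ L, EqCode n v s) ↔ cfg n s ∈ L.map (cfg n) := by
  simp [eqCode_iff]

theorem safeCertCode_iff {R : List RuleCode} {Φ : List (List ℕ)} {k K : ℕ} {L : List CfgCode} :
    SafeCertCode n R Φ k K L ↔
      SafeCert (rulesOf n R) (Φ.map (vec n)) k K (L.map (cfg n)) := by
  simp only [SafeCertCode, SafeCert, forall_mem_rulesOf, exists_eqCode_iff, List.forall_mem_map,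
    Fin.exists_iff, Fin.forall_iff, vec_mk, cfg_fst_mk, cfg_snd_mk, Fin.mk.injEq, exists_prop,
    cfg_truncCode]
  refine and_congr_right fun _ => forall₂_congr fun u _ => and_congr_right fun _ =>
    and_congr_right fun _ => or_congr Iff.rfl <| exists_congr fun i => and_congr_right fun hi =>
    and_congr_right fun _ => forall₂_congr fun e _ => ⟨fun h he heq => ?_, ?_⟩
  · rw [← cfg_bumpCode, ← cfg_fireCode]
    exact h heq
  · rintro h rfl
    have := h hi rfl
    rwa [← cfg_bumpCode, ← cfg_fireCode] at this

theorem loseCertCode_iff {R : List RuleCode} {Φ : List (List ℕ)} {k : ℕ}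
    {D : List (ℕ × CfgCode)} : LoseCertCode n R Φ k D ↔
      LoseCert (rulesOf n R) (Φ.map (vec n)) k (D.map (rankedCfg n)) := by
  simp only [LoseCertCode, LoseCert, exists_mem_rulesOf, List.forall_mem_map, List.exists_mem_map,
    Fin.exists_iff, Fin.forall_iff, rankedCfg, cfg_fst_mk, Fin.mk.injEq, exists_prop,
    badCode_iff, eqCode_iff]
  refine forall₂_congr fun d _ => or_congr Iff.rfl <| and_congr_right fun _ =>
    forall₃_congr fun i hi _ => exists_congr fun e => and_congr_right fun _ => ?_
  constructor
  · rintro ⟨rfl, h⟩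
    rw [cfg_fireCode _ hi] at h
    exact ⟨hi, rfl, h⟩
  · rintro ⟨hi, rfl, h⟩
    rw [cfg_fireCode _ hi]
    exact ⟨rfl, h⟩

theorem reachCertCode_iff {R : List RuleCode} {Φ : List (List ℕ)} {k K₁ K₂ : ℕ}
    {L₁ L₂ : List CfgCode} {P : List (ℕ × CfgCode)} : ReachCertCode n R Φ k K₁ K₂ L₁ L₂ P ↔
      ReachCert (rulesOf n R) (Φ.map (vec n)) k K₁ K₂ (L₁.map (cfg n)) (L₂.map (cfg n))
        (P.map (rankedCfg n)) := by
  simp only [ReachCertCode, ReachCert, exists_mem_rulesOf, forall_mem_rulesOf, List.forall_mem_map,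
    List.exists_mem_map, rankedCfg, cfg_fst_mk, Fin.mk.injEq, badCode_iff, exists_eqCode_iff,
    cfg_truncCode]
  simp only [eqCode_iff]
  refine forall₂_congr fun p _ => or_congr Iff.rfl <| and_congr_right fun _ =>
    exists_congr fun e => and_congr_right fun _ => ?_
  constructor
  · rintro ⟨he, h1, h2, h3⟩
    refine ⟨he, h1, fun e' he' hn heq => ?_, by rwa [← cfg_fireCode]⟩
    rw [← cfg_fireCode]
    exact h2 e' he' heq
  · rintro ⟨he, h1, h2, h3⟩
    refine ⟨he, h1, fun e' he' heq => ?_, by rwa [cfg_fireCode _ he]⟩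
    rw [cfg_fireCode _ (heq ▸ he)]
    exact h2 e' he' _ heq

theorem notReachCertCode_iff {R : List RuleCode} {Φ : List (List ℕ)} {k : ℕ}
    {D₁ D₂ : List (ℕ × CfgCode)} {T : List CfgCode} : NotReachCertCode n R Φ k D₁ D₂ T ↔
      NotReachCert (rulesOf n R) (Φ.map (vec n)) k (D₁.map (rankedCfg n)) (D₂.map (rankedCfg n))
        (T.map (cfg n)) := by
  simp only [NotReachCertCode, NotReachCert, exists_mem_rulesOf, forall_mem_rulesOf,
    List.forall_mem_map, List.exists_mem_map, rankedCfg, cfg_fst_mk, Fin.mk.injEq, badCode_iff,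
    eqCode_iff, leCode_iff]
  refine forall₂_congr fun m _ => or_congr Iff.rfl <| and_congr_right fun _ =>
    forall₃_congr fun e _ he => forall_congr' fun _ => ?_
  rw [cfg_fireCode _ he]
  refine or_congr (exists_congr fun e' => and_congr_right fun _ => ?_) Iff.rfl
  constructor
  · rintro ⟨heq, h⟩
    have he' := heq ▸ he
    rw [cfg_fireCode _ he'] at h
    exact ⟨he', heq, h⟩
  · rintro ⟨he', heq, h⟩
    rw [cfg_fireCode _ he']
    exact ⟨heq, h⟩

end Correct

end FairGame

/-! ### Primitive recursiveness of the checks, and the decision procedure -/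

namespace FairGame

section Primrec

variable {α : Type*} [Primcodable α] {n k K : α → ℕ} {s t : α → CfgCode} {e : α → RuleCode}
  {Φ : α → List (List ℕ)}

theorem primrec_getD {f : α → List ℕ} {g : α → ℕ} (hf : Primrec f) (hg : Primrec g) :
    Primrec fun a => (f a).getD (g a) 0 :=
  (Primrec.list_getD 0).comp hf hg

theorem primrec_fireCode (hn : Primrec n) (hs : Primrec s) (he : Primrec e) :
    Primrec fun a => fireCode (n a) (s a) (e a) := by
  have hi : Primrec fun x : α × ℕ => x.2 := Primrec.snd
  have hs1 := primrec_getD (Primrec.fst.comp (hs.comp Primrec.fst)) hi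
  have hs2 := primrec_getD (Primrec.snd.comp (hs.comp Primrec.fst)) hi
  have he' := he.comp (Primrec.fst (α := α) (β := ℕ))
  have he1 := Primrec.fst.comp he'
  have he2 := primrec_getD (Primrec.fst.comp (Primrec.snd.comp he')) hi
  refine Primrec.pair (Primrec.list_map (Primrec.list_range.comp hn) ?_)
    (Primrec.list_map (Primrec.list_range.comp hn) ?_)
  · exact Primrec.nat_add.comp (Primrec.nat_sub.comp hs1
      (Primrec.ite (Primrec.eq.comp hi he1) (Primrec.const 1) (Primrec.const 0))) he2
  · exact Primrec.ite (Primrec.eq.comp he1 hi) (Primrec.const 0)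
      (Primrec.ite (Primrec.nat_le.comp (Primrec.const 1) hs1)
        (Primrec.nat_add.comp hs2 (Primrec.const 1)) (Primrec.const 0))

theorem primrec_truncCode (hn : Primrec n) (hK : Primrec K) (hs : Primrec s) :
    Primrec fun a => truncCode (n a) (K a) (s a) :=
  Primrec.pair (Primrec.list_map (Primrec.list_range.comp hn) (Primrec.nat_min.comp
    (primrec_getD (Primrec.fst.comp (hs.comp Primrec.fst)) Primrec.snd) (hK.comp Primrec.fst)))
    (Primrec.snd.comp hs)

theorem primrec_bumpCode (hn : Primrec n) (hK : Primrec K) (hs : Primrec s) :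
    Primrec fun a => bumpCode (n a) (K a) (s a) := by
  have hs1 := primrec_getD (Primrec.fst.comp (hs.comp (Primrec.fst (α := α) (β := ℕ)))) Primrec.snd
  exact Primrec.pair (Primrec.list_map (Primrec.list_range.comp hn) (Primrec.nat_add.comp hs1
    (Primrec.ite (Primrec.eq.comp hs1 (hK.comp Primrec.fst)) (Primrec.const 1) (Primrec.const 0))))
    (Primrec.snd.comp hs)

theorem primrecPred_eqCode (hn : Primrec n) (hs : Primrec s) (ht : Primrec t) :
    PrimrecPred fun a => EqCode (n a) (s a) (t a) := by
  have hs' := hs.comp (Primrec.fst (α := α) (β := ℕ))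
  have ht' := ht.comp (Primrec.fst (α := α) (β := ℕ))
  exact PrimrecPred.forall_lt_of hn (PrimrecPred.and
    (Primrec.eq.comp (primrec_getD (Primrec.fst.comp hs') Primrec.snd)
      (primrec_getD (Primrec.fst.comp ht') Primrec.snd))
    (Primrec.eq.comp (primrec_getD (Primrec.snd.comp hs') Primrec.snd)
      (primrec_getD (Primrec.snd.comp ht') Primrec.snd)))

theorem primrecPred_leCode (hn : Primrec n) (hs : Primrec s) (ht : Primrec t) :
    PrimrecPred fun a => LeCode (n a) (s a) (t a) := by
  have hs' := hs.comp (Primrec.fst (α := α) (β := ℕ))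
  have ht' := ht.comp (Primrec.fst (α := α) (β := ℕ))
  exact PrimrecPred.forall_lt_of hn (PrimrecPred.and
    (Primrec.nat_le.comp (primrec_getD (Primrec.fst.comp hs') Primrec.snd)
      (primrec_getD (Primrec.fst.comp ht') Primrec.snd))
    (Primrec.nat_le.comp (primrec_getD (Primrec.snd.comp hs') Primrec.snd)
      (primrec_getD (Primrec.snd.comp ht') Primrec.snd)))

theorem primrecPred_present {i : α → ℕ} (hs : Primrec s) (hi : Primrec i) :
    PrimrecPred fun a => 1 ≤ (s a).1.getD (i a) 0 :=
  Primrec.nat_le.comp (Primrec.const 1) (primrec_getD (Primrec.fst.comp hs) hi)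

theorem primrecPred_late (hn : Primrec n) (hk : Primrec k) (hs : Primrec s) :
    PrimrecPred fun a => ∃ i < n a, 1 ≤ (s a).1.getD i 0 ∧ k a ≤ (s a).2.getD i 0 := by
  have hs' := hs.comp (Primrec.fst (α := α) (β := ℕ))
  exact PrimrecPred.exists_lt_of hn (PrimrecPred.and (primrecPred_present hs' Primrec.snd)
    (Primrec.nat_le.comp (hk.comp Primrec.fst)
      (primrec_getD (Primrec.snd.comp hs') Primrec.snd)))

theorem primrecPred_badCode (hn : Primrec n) (hΦ : Primrec Φ) (hk : Primrec k) (hs : Primrec s) :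
    PrimrecPred fun a => BadCode (n a) (Φ a) (k a) (s a) := by
  refine PrimrecPred.or (PrimrecPred.exists_mem hΦ (PrimrecPred.forall_lt_of
    (hn.comp Primrec.fst) (Primrec.nat_le.comp ?_ ?_))) (primrecPred_late hn hk hs)
  · exact primrec_getD (Primrec.snd.comp Primrec.fst) Primrec.snd
  · exact primrec_getD (Primrec.fst.comp (hs.comp (Primrec.fst.comp Primrec.fst))) Primrec.snd

theorem primrecPred_safeCertCode : PrimrecPred
    fun x : ℕ × List RuleCode × List (List ℕ) × ℕ × ℕ × List CfgCode =>
      SafeCertCode x.1 x.2.1 x.2.2.1 x.2.2.2.1 x.2.2.2.2.1 x.2.2.2.2.2 := by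
  unfold SafeCertCode
  repeat' with_reducible first
    | exact Primrec.const _
    | exact Primrec.id
    | exact Primrec.fst
    | exact Primrec.snd
    | refine PrimrecPred.and ?_ ?_
    | refine PrimrecPred.or ?_ ?_
    | refine PrimrecPred.not ?_
    | refine PrimrecPred.exists_mem ?_ ?_
    | refine PrimrecPred.forall_mem ?_ ?_
    | refine PrimrecPred.exists_lt_of ?_ ?_
    | refine PrimrecPred.forall_lt_of ?_ ?_
    | refine PrimrecPred.imp ?_ ?_
    | refine primrecPred_eqCode ?_ ?_ ?_
    | refine Primrec.nat_lt.comp ?_ ?_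
    | refine Primrec.nat_le.comp ?_ ?_
    | refine Primrec.eq.comp ?_ ?_
    | refine primrec_truncCode ?_ ?_ ?_
    | refine primrec_bumpCode ?_ ?_ ?_
    | refine primrec_fireCode ?_ ?_ ?_
    | refine primrec_getD ?_ ?_
    | refine Primrec.fst.comp ?_
    | refine Primrec.snd.comp ?_

theorem primrecPred_loseCertCode : PrimrecPred
    fun x : ℕ × List RuleCode × List (List ℕ) × ℕ × List (ℕ × CfgCode) =>
      LoseCertCode x.1 x.2.1 x.2.2.1 x.2.2.2.1 x.2.2.2.2 := by
  unfold LoseCertCode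
  repeat' with_reducible first
    | exact Primrec.const _
    | exact Primrec.id
    | exact Primrec.fst
    | exact Primrec.snd
    | refine PrimrecPred.and ?_ ?_
    | refine PrimrecPred.or ?_ ?_
    | refine PrimrecPred.exists_mem ?_ ?_
    | refine PrimrecPred.forall_mem ?_ ?_
    | refine PrimrecPred.exists_lt_of ?_ ?_
    | refine PrimrecPred.forall_lt_of ?_ ?_
    | refine PrimrecPred.imp ?_ ?_
    | refine primrecPred_badCode ?_ ?_ ?_ ?_
    | refine primrecPred_eqCode ?_ ?_ ?_
    | refine Primrec.nat_lt.comp ?_ ?_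
    | refine Primrec.nat_le.comp ?_ ?_
    | refine Primrec.eq.comp ?_ ?_
    | refine primrec_fireCode ?_ ?_ ?_
    | refine primrec_getD ?_ ?_
    | refine Primrec.fst.comp ?_
    | refine Primrec.snd.comp ?_

theorem primrecPred_reachCertCode : PrimrecPred
    fun x : (ℕ × List RuleCode × List (List ℕ) × ℕ) ×
        (ℕ × ℕ × List CfgCode × List CfgCode × List (ℕ × CfgCode)) =>
      ReachCertCode x.1.1 x.1.2.1 x.1.2.2.1 x.1.2.2.2 x.2.1 x.2.2.1 x.2.2.2.1 x.2.2.2.2.1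
        x.2.2.2.2.2 := by
  unfold ReachCertCode
  repeat' with_reducible first
    | exact Primrec.const _
    | exact Primrec.id
    | exact Primrec.fst
    | exact Primrec.snd
    | refine PrimrecPred.and ?_ ?_
    | refine PrimrecPred.or ?_ ?_
    | refine PrimrecPred.not ?_
    | refine PrimrecPred.exists_mem ?_ ?_
    | refine PrimrecPred.forall_mem ?_ ?_
    | refine PrimrecPred.imp ?_ ?_
    | refine primrecPred_badCode ?_ ?_ ?_ ?_
    | refine primrecPred_eqCode ?_ ?_ ?_
    | refine Primrec.nat_lt.comp ?_ ?_
    | refine Primrec.nat_le.comp ?_ ?_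
    | refine Primrec.eq.comp ?_ ?_
    | refine primrec_truncCode ?_ ?_ ?_
    | refine primrec_fireCode ?_ ?_ ?_
    | refine primrec_getD ?_ ?_
    | refine Primrec.fst.comp ?_
    | refine Primrec.snd.comp ?_

theorem primrecPred_notReachCertCode : PrimrecPred
    fun x : (ℕ × List RuleCode × List (List ℕ) × ℕ) ×
        (List (ℕ × CfgCode) × List (ℕ × CfgCode) × List CfgCode) =>
      NotReachCertCode x.1.1 x.1.2.1 x.1.2.2.1 x.1.2.2.2 x.2.1 x.2.2.1 x.2.2.2 := by
  unfold NotReachCertCode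
  repeat' with_reducible first
    | exact Primrec.const _
    | exact Primrec.id
    | exact Primrec.fst
    | exact Primrec.snd
    | refine PrimrecPred.and ?_ ?_
    | refine PrimrecPred.or ?_ ?_
    | refine PrimrecPred.exists_mem ?_ ?_
    | refine PrimrecPred.forall_mem ?_ ?_
    | refine PrimrecPred.imp ?_ ?_
    | refine primrecPred_badCode ?_ ?_ ?_ ?_
    | refine primrecPred_eqCode ?_ ?_ ?_
    | refine primrecPred_leCode ?_ ?_ ?_
    | refine Primrec.nat_lt.comp ?_ ?_
    | refine Primrec.nat_le.comp ?_ ?_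
    | refine Primrec.eq.comp ?_ ?_
    | refine primrec_fireCode ?_ ?_ ?_
    | refine primrec_getD ?_ ?_
    | refine Primrec.fst.comp ?_
    | refine Primrec.snd.comp ?_

section Comp

variable {R : α → List RuleCode}

theorem primrecPred_safeCertCode_comp {L : α → List CfgCode} (hn : Primrec n) (hR : Primrec R)
    (hΦ : Primrec Φ) (hk : Primrec k) (hK : Primrec K) (hL : Primrec L) :
    PrimrecPred fun a => SafeCertCode (n a) (R a) (Φ a) (k a) (K a) (L a) :=
  primrecPred_safeCertCode.comp (hn.pair (hR.pair (hΦ.pair (hk.pair (hK.pair hL)))))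

theorem primrecPred_loseCertCode_comp {D : α → List (ℕ × CfgCode)} (hn : Primrec n) (hR : Primrec R)
    (hΦ : Primrec Φ) (hk : Primrec k) (hD : Primrec D) :
    PrimrecPred fun a => LoseCertCode (n a) (R a) (Φ a) (k a) (D a) :=
  primrecPred_loseCertCode.comp (hn.pair (hR.pair (hΦ.pair (hk.pair hD))))

theorem primrecPred_reachCertCode_comp {K' : α → ℕ} {L L' : α → List CfgCode}
    {P : α → List (ℕ × CfgCode)} (hn : Primrec n) (hR : Primrec R) (hΦ : Primrec Φ)
    (hk : Primrec k) (hK : Primrec K) (hK' : Primrec K') (hL : Primrec L) (hL' : Primrec L')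
    (hP : Primrec P) : PrimrecPred fun a =>
      ReachCertCode (n a) (R a) (Φ a) (k a) (K a) (K' a) (L a) (L' a) (P a) :=
  primrecPred_reachCertCode.comp ((hn.pair (hR.pair (hΦ.pair hk))).pair
    (hK.pair (hK'.pair (hL.pair (hL'.pair hP)))))

theorem primrecPred_notReachCertCode_comp {D D' : α → List (ℕ × CfgCode)} {T : α → List CfgCode}
    (hn : Primrec n) (hR : Primrec R) (hΦ : Primrec Φ) (hk : Primrec k) (hD : Primrec D)
    (hD' : Primrec D') (hT : Primrec T) : PrimrecPred fun a =>
      NotReachCertCode (n a) (R a) (Φ a) (k a) (D a) (D' a) (T a) :=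
  primrecPred_notReachCertCode.comp ((hn.pair (hR.pair (hΦ.pair hk))).pair
    (hD.pair (hD'.pair hT)))

end Comp

end Primrec

/-- `b` certifies that `CanReach` fails in the instance with code `c`, or that `c` has a type
without a rule. -/
def RejectCode (c : PBPP.InstanceCode)
    (b : List (ℕ × CfgCode) × List (ℕ × CfgCode) × List CfgCode) : Prop :=
  (∃ i < c.1, ∀ e ∈ c.2.1, ¬ e.1 = i) ∨
    (LoseCertCode c.1 c.2.1 c.2.2.1 c.2.2.2.2 b.1 ∧ LoseCertCode c.1 c.2.1 [] c.2.2.2.2 b.2.1 ∧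
      NotReachCertCode c.1 c.2.1 c.2.2.1 c.2.2.2.2 b.1 b.2.1 b.2.2 ∧
      ∃ t ∈ b.2.2, LeCode c.1 t (c.2.2.2.1, []))

/-- `b` certifies that `CanReach` holds in the instance with code `c`. -/
def AcceptCode (c : PBPP.InstanceCode)
    (b : ℕ × ℕ × List CfgCode × List CfgCode × List (ℕ × CfgCode)) : Prop :=
  SafeCertCode c.1 c.2.1 c.2.2.1 c.2.2.2.2 b.1 b.2.2.1 ∧
    SafeCertCode c.1 c.2.1 [] c.2.2.2.2 b.2.1 b.2.2.2.1 ∧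
    ReachCertCode c.1 c.2.1 c.2.2.1 c.2.2.2.2 b.1 b.2.1 b.2.2.1 b.2.2.2.1 b.2.2.2.2 ∧
    ∃ t ∈ b.2.2.2.2, EqCode c.1 t.2 (c.2.2.2.1, [])

theorem primrecPred_rejectCode : PrimrecPred fun x : PBPP.InstanceCode ×
    (List (ℕ × CfgCode) × List (ℕ × CfgCode) × List CfgCode) => RejectCode x.1 x.2 := by
  unfold RejectCode
  repeat' with_reducible first
    | exact Primrec.const _
    | exact Primrec.fst
    | exact Primrec.snd
    | refine PrimrecPred.or ?_ ?_
    | refine PrimrecPred.and ?_ ?_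
    | refine PrimrecPred.not ?_
    | refine PrimrecPred.exists_lt_of ?_ ?_
    | refine PrimrecPred.exists_mem ?_ ?_
    | refine PrimrecPred.forall_mem ?_ ?_
    | refine primrecPred_loseCertCode_comp ?_ ?_ ?_ ?_ ?_
    | refine primrecPred_notReachCertCode_comp ?_ ?_ ?_ ?_ ?_ ?_ ?_
    | refine primrecPred_leCode ?_ ?_ ?_
    | refine Primrec.eq.comp ?_ ?_
    | refine Primrec.fst.comp ?_
    | refine Primrec.snd.comp ?_
    | refine Primrec.pair ?_ ?_

theorem primrecPred_acceptCode : PrimrecPred fun x : PBPP.InstanceCode ×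
    (ℕ × ℕ × List CfgCode × List CfgCode × List (ℕ × CfgCode)) => AcceptCode x.1 x.2 := by
  unfold AcceptCode
  repeat' with_reducible first
    | exact Primrec.const _
    | exact Primrec.fst
    | exact Primrec.snd
    | refine PrimrecPred.and ?_ ?_
    | refine PrimrecPred.exists_mem ?_ ?_
    | refine primrecPred_safeCertCode_comp ?_ ?_ ?_ ?_ ?_ ?_
    | refine primrecPred_reachCertCode_comp ?_ ?_ ?_ ?_ ?_ ?_ ?_ ?_ ?_
    | refine primrecPred_eqCode ?_ ?_ ?_
    | refine Primrec.fst.comp ?_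
    | refine Primrec.snd.comp ?_
    | refine Primrec.pair ?_ ?_

/-- Reachability in the fairness game is decidable, uniformly in the codes of instances. -/
theorem exists_computable_canReach :
    ∃ f : PBPP.InstanceCode → Bool, Computable f ∧ ∀ c : PBPP.InstanceCode,
      (∀ X, ∃ r ∈ rulesOf c.1 c.2.1, r.1 = X) →
      (f c = true ↔ ¬ CanReach (rulesOf c.1 c.2.1) (c.2.2.1.map (vec c.1)) c.2.2.2.2
        (vec c.1 c.2.2.2.1, fun _ => 0)) := by
  have hvalid : ∀ c : PBPP.InstanceCode, (∀ X, ∃ r ∈ rulesOf c.1 c.2.1, r.1 = X) ↔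
      ¬ ∃ i < c.1, ∀ e ∈ c.2.1, ¬ e.1 = i := by
    intro c
    push Not
    simp only [exists_mem_rulesOf, Fin.forall_iff, Fin.mk.injEq]
    refine forall₂_congr fun i hi => exists_congr fun e => and_congr_right fun _ =>
      ⟨fun ⟨_, h⟩ => h, fun h => ⟨h ▸ hi, h⟩⟩
  -- Missing entries are read as `0`, so the empty list codes the initial waiting times.
  have hinit : ∀ c : PBPP.InstanceCode,
      cfg c.1 (c.2.2.2.1, []) = (vec c.1 c.2.2.2.1, fun _ => 0) := by
    intro c
    simp [cfg, funext_iff, vec]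
  have hpc : ∀ c : PBPP.InstanceCode, (∀ X, ∃ r ∈ rulesOf c.1 c.2.1, r.1 = X) →
      ((∃ b, RejectCode c b) ↔ ¬ CanReach (rulesOf c.1 c.2.1) (c.2.2.1.map (vec c.1)) c.2.2.2.2
        (vec c.1 c.2.2.2.1, fun _ => 0)) := by
    intro c hc
    have hex : (∃ b, RejectCode c b) ↔ ∃ D₁ D₂ T, RejectCode c (D₁, D₂, T) := by
      simp only [Prod.exists]
    rw [hex]
    simp only [RejectCode, (hvalid c).1 hc, false_or, loseCertCode_iff, notReachCertCode_iff,
      leCode_iff, not_canReach_iff_exists_cert hc, hinit, List.map_nil]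
    rw [(List.map_surjective_iff.2 rankedCfg_surjective).exists]
    refine exists_congr fun D₁ => ?_
    rw [(List.map_surjective_iff.2 rankedCfg_surjective).exists]
    refine exists_congr fun D₂ => ?_
    rw [(List.map_surjective_iff.2 cfg_surjective).exists]
    simp only [List.exists_mem_map]
  have hqc : ∀ c : PBPP.InstanceCode, (∀ X, ∃ r ∈ rulesOf c.1 c.2.1, r.1 = X) →
      ((∃ b, AcceptCode c b) ↔ CanReach (rulesOf c.1 c.2.1) (c.2.2.1.map (vec c.1)) c.2.2.2.2
        (vec c.1 c.2.2.2.1, fun _ => 0)) := by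
    intro c hc
    have hex : (∃ b, AcceptCode c b) ↔
        ∃ K₁ K₂ L₁ L₂ P, AcceptCode c (K₁, K₂, L₁, L₂, P) := by simp only [Prod.exists]
    rw [hex]
    simp only [AcceptCode, safeCertCode_iff, reachCertCode_iff, eqCode_iff,
      canReach_iff_exists_cert hc, hinit, List.map_nil]
    refine exists_congr fun K₁ => exists_congr fun K₂ => ?_
    rw [(List.map_surjective_iff.2 cfg_surjective).exists]
    refine exists_congr fun L₁ => ?_
    rw [(List.map_surjective_iff.2 cfg_surjective).exists]
    refine exists_congr fun L₂ => ?_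
    rw [(List.map_surjective_iff.2 rankedCfg_surjective).exists]
    simp only [List.exists_mem_map, rankedCfg]
  obtain ⟨f, hf, hfs⟩ := exists_computable_of_certificates primrecPred_rejectCode
      primrecPred_acceptCode fun c => by
    by_cases hc : ∀ X, ∃ r ∈ rulesOf c.1 c.2.1, r.1 = X
    · rw [hpc c hc, hqc c hc]
      exact (em _).symm
    -- Codes having a type without a rule are rejected outright, which keeps the search total.
    · exact Or.inl ⟨([], [], []), Or.inl (not_not.1 fun h => hc ((hvalid c).2 h))⟩
  refine ⟨f, hf, fun c hc => ⟨fun h => (hpc c hc).1 ((hfs c).1 h), fun h => ?_⟩⟩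
  by_contra hfc
  exact h ((hqc c hc).1 ((hfs c).2 (by simpa using hfc)))

end FairGame

/-! ### Cylinder probabilities of runs -/

namespace MDP

open scoped ENNReal

variable {Q A : Type}

/-- The list of the first `m` steps of a run. -/
def pre (m : ℕ) (ω : ℕ → Step Q A) : List (Step Q A) := (List.range m).map ω

theorem pre_succ (m : ℕ) (ω : ℕ → Step Q A) : pre (m + 1) ω = pre m ω ++ [ω m] := by
  simp [pre, List.range_succ]

theorem length_pre (m : ℕ) (ω : ℕ → Step Q A) : (pre m ω).length = m := by simp [pre]

theorem ofFn_eq_pre (m : ℕ) (ω : ℕ → Step Q A) : (List.ofFn fun i : Fin m => ω i) = pre m ω := by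
  apply List.ext_getElem <;> simp [pre]

/-- The set of runs that start with the steps `w`. -/
def cyl (w : List (Step Q A)) : Set (ℕ → Step Q A) := {ω | pre w.length ω = w}

theorem mem_cyl {w : List (Step Q A)} {ω : ℕ → Step Q A} : ω ∈ cyl w ↔ pre w.length ω = w :=
  Iff.rfl

theorem mem_cyl_concat {w : List (Step Q A)} {s : Step Q A} {ω : ℕ → Step Q A} :
    ω ∈ cyl (w ++ [s]) ↔ ω ∈ cyl w ∧ ω w.length = s := by
  rw [mem_cyl, mem_cyl, List.length_append, List.length_singleton, pre_succ]
  constructor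
  · intro h
    obtain ⟨h₁, h₂⟩ := List.append_inj' h rfl
    exact ⟨h₁, List.singleton_inj.1 h₂⟩
  · rintro ⟨h₁, h₂⟩
    rw [h₁, h₂]

theorem measurableSet_reach (F : Set Q) :
    MeasurableSet (reach F : Set (ℕ → Step Q A)) := by
  have : (reach F : Set (ℕ → Step Q A)) = ⋃ i, (fun ω => ω i) ⁻¹' {s | s.state ∈ F} := by
    ext ω
    simp [reach]
  rw [this]
  exact MeasurableSet.iUnion fun i => measurable_pi_apply i (MeasurableSet.of_discrete)

theorem nextStep_apply (D : MDP Q A) (σ : D.Scheduler) (w : List (Step Q A)) (c s : Step Q A) :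
    D.nextStep σ w c s = D.trans c.state c.act s.state * σ.choose (w, s.state) s.act := by
  rw [nextStep, PMF.bind_apply, tsum_eq_single s.state]
  · congr 1
    rw [PMF.map_apply, tsum_eq_single s.act]
    · simp
    · intro b hb
      exact if_neg fun h => hb (congrArg Step.act h).symm
  · intro t ht
    rw [PMF.map_apply, ENNReal.tsum_eq_zero.2, mul_zero]
    exact fun b => if_neg fun h => ht (congrArg Step.state h).symm

variable [Countable Q] [Countable A]

theorem measurableSet_pre (m : ℕ) (P : List (Step Q A) → Prop) :
    MeasurableSet {ω : ℕ → Step Q A | P (pre m ω)} := by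
  induction m generalizing P with
  | zero => simp [pre]
  | succ m ih =>
    have : {ω : ℕ → Step Q A | P (pre (m + 1) ω)} =
        ⋃ s, {ω | P (pre m ω ++ [s])} ∩ (fun ω => ω m) ⁻¹' {s} := by
      ext ω
      simp [pre_succ]
    rw [this]
    exact MeasurableSet.iUnion fun s => (ih fun w => P (w ++ [s])).inter
      (measurable_pi_apply m (measurableSet_singleton s))

theorem measurableSet_cyl (w : List (Step Q A)) : MeasurableSet (cyl w) :=
  measurableSet_pre w.length (· = w)

variable (D : MDP Q A) (σ : D.Scheduler) (s₀ : Q)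

instance : IsProbabilityMeasure (D.firstStep σ s₀).toMeasure :=
  PMF.toMeasure.isProbabilityMeasure _

instance : IsProbabilityMeasure (D.runMeasure σ s₀) := by
  unfold runMeasure
  infer_instance

/-- This is the disintegration of the trajectory measure over the first steps, evaluated on a
product of two singletons. -/
theorem runMeasure_cyl_concat (w : List (Step Q A)) (c s : Step Q A) :
    D.runMeasure σ s₀ (cyl (w ++ [c] ++ [s])) =
      D.runMeasure σ s₀ (cyl (w ++ [c])) * D.nextStep σ (w ++ [c]) c s := by
  -- An arbitrary run through the cylinder, used to name the point `h` at which the kernel is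
  -- evaluated.
  obtain ⟨ω₀, hω₀⟩ : ∃ ω₀ : ℕ → Step Q A, pre (w.length + 1) ω₀ = w ++ [c] := by
    refine ⟨fun i => (w ++ [c]).getD i c, ?_⟩
    apply List.ext_getElem
    · simp [pre]
    · intro i h₁ h₂
      simp only [pre, List.getElem_map, List.getElem_range]
      exact List.getD_eq_getElem _ _ h₂
  let h : Π _ : Finset.Iic w.length, Step Q A := Preorder.frestrictLe w.length ω₀
  have hpre : ∀ ω : ℕ → Step Q A, Preorder.frestrictLe w.length ω = h ↔ ω ∈ cyl (w ++ [c]) := by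
    intro ω
    rw [mem_cyl, List.length_append, List.length_singleton, ← hω₀]
    simp [h, funext_iff, pre, Preorder.frestrictLe_apply]
  have hc : ω₀ w.length = c := by
    have : ω₀ ∈ cyl (w ++ [c]) := by
      rw [mem_cyl, List.length_append, List.length_singleton, hω₀]
    exact (mem_cyl_concat.1 this).2
  have key := congrArg (fun ρ => ρ ({h} ×ˢ {s}))
    (Kernel.map_frestrictLe_trajMeasure_compProd_eq_map_trajMeasure (X := fun _ => Step Q A)
      (μ₀ := (D.firstStep σ s₀).toMeasure) (κ := D.stepKernel σ) (a := w.length))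
  change _ = (Measure.map _ (D.runMeasure σ s₀)) _ at key
  change ((Measure.map _ (D.runMeasure σ s₀)).compProd _) _ = _ at key
  rw [Measure.compProd_apply_prod (measurableSet_singleton _) (measurableSet_singleton _),
    Measure.restrict_singleton, lintegral_smul_measure, lintegral_dirac,
    Measure.map_apply (by fun_prop) (measurableSet_singleton _),
    Measure.map_apply (by fun_prop) ((measurableSet_singleton _).prod (measurableSet_singleton _))]
    at key
  have e₁ : Preorder.frestrictLe (π := fun _ => Step Q A) w.length ⁻¹' {h} = cyl (w ++ [c]) := by
    ext ω
    exact hpre ω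
  have e₂ : (fun x : ℕ → Step Q A => (Preorder.frestrictLe (π := fun _ => Step Q A) w.length x,
      x (w.length + 1))) ⁻¹' ({h} ×ˢ {s}) = cyl (w ++ [c] ++ [s]) := by
    ext ω
    rw [mem_cyl_concat, ← hpre ω]
    simp
  rw [e₁, e₂] at key
  rw [← key, smul_eq_mul]
  congr 1
  change (D.nextStep σ (List.ofFn fun i : Fin (w.length + 1) => ω₀ i)
    (ω₀ w.length)).toMeasure {s} = _
  rw [PMF.toMeasure_apply_singleton _ _ (measurableSet_singleton _), ofFn_eq_pre, hω₀, hc]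

theorem runMeasure_cyl_singleton (s : Step Q A) :
    D.runMeasure σ s₀ (cyl [s]) = D.firstStep σ s₀ s := by
  have h0 : (D.runMeasure σ s₀).map (Preorder.frestrictLe (π := fun _ => Step Q A) 0) =
      (D.firstStep σ s₀).toMeasure.map
        (MeasurableEquiv.piUnique (fun _ : Finset.Iic 0 => Step Q A)).symm := by
    rw [runMeasure, Kernel.trajMeasure, Measure.map_comp _ _ (by fun_prop),
      Kernel.traj_map_frestrictLe_of_le le_rfl, Measure.deterministic_comp_eq_map]
    exact Measure.map_id
  have key := congrArg (fun ρ => ρ {fun _ => s}) h0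
  rw [Measure.map_apply (by fun_prop) (measurableSet_singleton _),
    Measure.map_apply (by fun_prop) (measurableSet_singleton _)] at key
  have e₁ : Preorder.frestrictLe (π := fun _ => Step Q A) 0 ⁻¹' {fun _ => s} = cyl [s] := by
    ext ω
    simp [cyl, pre, funext_iff, Preorder.frestrictLe_apply]
  have e₂ : (MeasurableEquiv.piUnique (fun _ : Finset.Iic 0 => Step Q A)).symm ⁻¹' {fun _ => s} =
      {s} := by
    ext x
    simp [funext_iff, MeasurableEquiv.piUnique]
  rw [e₁, e₂, PMF.toMeasure_apply_singleton _ _ (measurableSet_singleton _)] at key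
  exact key

/-- A list of steps that is an initial part of a run with positive probability. -/
def Possible (w : List (Step Q A)) : Prop := D.runMeasure σ s₀ (cyl w) ≠ 0

variable {D σ s₀}

theorem possible_singleton {s : Step Q A} :
    Possible D σ s₀ [s] ↔ s.state = s₀ ∧ s.act ∈ (σ.choose ([], s.state)).support := by
  rw [Possible, runMeasure_cyl_singleton, ← PMF.mem_support_iff, firstStep, PMF.support_map]
  constructor
  · rintro ⟨b, hb, rfl⟩
    exact ⟨rfl, hb⟩
  · rintro ⟨h₁, h₂⟩
    exact ⟨s.act, h₁ ▸ h₂, by ext <;> simp [h₁]⟩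

theorem possible_concat {w : List (Step Q A)} {c s : Step Q A} :
    Possible D σ s₀ (w ++ [c] ++ [s]) ↔ Possible D σ s₀ (w ++ [c]) ∧
      s.state ∈ (D.trans c.state c.act).support ∧
      s.act ∈ (σ.choose (w ++ [c], s.state)).support := by
  rw [Possible, runMeasure_cyl_concat, nextStep_apply]
  simp [Possible]

theorem Possible.act_mem {w : List (Step Q A)} {s : Step Q A}
    (h : Possible D σ s₀ (w ++ [s])) : s.act ∈ (σ.choose (w, s.state)).support := by
  rcases List.eq_nil_or_concat' w with rfl | ⟨w, c, rfl⟩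
  · exact (possible_singleton.1 h).2
  · exact (possible_concat.1 h).2.2

theorem Possible.act_enabled {w : List (Step Q A)} {s : Step Q A}
    (h : Possible D σ s₀ (w ++ [s])) : s.act ∈ D.enabled s.state :=
  σ.support_subset _ h.act_mem

theorem Possible.exists_concat {w : List (Step Q A)} {c : Step Q A}
    (h : Possible D σ s₀ (w ++ [c])) {t : Q} (ht : t ∈ (D.trans c.state c.act).support) :
    ∃ b, Possible D σ s₀ (w ++ [c] ++ [⟨t, b⟩]) := by
  obtain ⟨b, hb⟩ := (σ.choose (w ++ [c], t)).support_nonempty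
  exact ⟨b, possible_concat.2 ⟨h, ht, hb⟩⟩

variable (D σ s₀)

/-- Almost surely, all initial parts of the run have positive probability. -/
theorem ae_possible : ∀ᵐ ω ∂(D.runMeasure σ s₀), ∀ m, Possible D σ s₀ (pre m ω) := by
  rw [ae_all_iff]
  intro m
  -- There are only countably many lists of steps, so the union of the null cylinders is null.
  refine measure_mono_null (t := ⋃ w ∈ {w | ¬ Possible D σ s₀ w}, cyl w) (fun ω hω => ?_) ?_
  · refine Set.mem_biUnion (x := pre m ω) hω ?_
    rw [mem_cyl, length_pre]
  · rw [measure_biUnion_null_iff (Set.to_countable _)]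
    exact fun w hw => not_not.1 hw

/-- An event that depends on the first `m` steps is a disjoint union of cylinders. -/
theorem measure_pre_le {μ ν : Measure (ℕ → Step Q A)} (m : ℕ) (P : List (Step Q A) → Prop)
    (h : ∀ w, w.length = m → P w → μ (cyl w) ≤ ν (cyl w)) :
    μ {ω | P (pre m ω)} ≤ ν {ω | P (pre m ω)} := by
  have hE : {ω : ℕ → Step Q A | P (pre m ω)} = ⋃ w ∈ {w | w.length = m ∧ P w}, cyl w := by
    ext ω
    simp only [Set.mem_iUnion, exists_prop, mem_cyl]
    constructor
    · intro hP
      exact ⟨pre m ω, ⟨length_pre m ω, hP⟩, by rw [length_pre]⟩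
    · rintro ⟨w, ⟨rfl, hP⟩, hw⟩
      rw [← hw] at hP
      simpa [length_pre] using hP
  have hd : {w : List (Step Q A) | w.length = m ∧ P w}.PairwiseDisjoint cyl := by
    rintro w ⟨hw, -⟩ w' ⟨hw', -⟩ hne
    refine Set.disjoint_left.2 fun ω h₁ h₂ => hne ?_
    rw [mem_cyl, hw] at h₁
    rw [mem_cyl, hw'] at h₂
    exact h₁.symm.trans h₂
  rw [hE, measure_biUnion (Set.to_countable _) hd fun w _ => measurableSet_cyl w,
    measure_biUnion (Set.to_countable _) hd fun w _ => measurableSet_cyl w]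
  exact ENNReal.tsum_le_tsum fun w => h w w.2.1 w.2.2

end MDP

/-! ### Strategies in the fairness game -/

namespace FairGame

variable {Γ : Type} [DecidableEq Γ] {R : List (Γ × (Γ → ℕ))} {Φ : List (Γ → ℕ)} {k : ℕ}
  {q : Cfg Γ}

/-- `CanReach` with a bound on the number of steps before a safe configuration. -/
def ReachIn (R : List (Γ × (Γ → ℕ))) (Φ : List (Γ → ℕ)) (k : ℕ) : ℕ → Cfg Γ → Prop
  | 0, q => Safe R Φ k q
  | n + 1, q => ¬ Bad Φ k q ∧ ∃ r ∈ R, 1 ≤ q.1 r.1 ∧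
      (∀ r' ∈ R, r'.1 = r.1 → Safe R [] k (fire q r')) ∧ ReachIn R Φ k n (fire q r)

theorem CanReach.exists_reachIn (h : CanReach R Φ k q) : ∃ n, ReachIn R Φ k n q := by
  induction h with
  | safe h => exact ⟨0, h⟩
  | step hb hr h1 hs _ ih =>
    obtain ⟨n, hn⟩ := ih
    exact ⟨n + 1, hb, _, hr, h1, hs, hn⟩

theorem ReachIn.canReach : ∀ {n : ℕ} {q : Cfg Γ}, ReachIn R Φ k n q → CanReach R Φ k q
  | 0, _, h => .safe h
  | _ + 1, _, ⟨hb, _, hr, h1, hs, hn⟩ => .step hb hr h1 hs hn.canReach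

/-- The first move of a path has only outcomes that are safe for fairness, so the rules cannot force
lateness from its start. -/
theorem CanReach.safe_nil (h : CanReach R Φ k q) : Safe R [] k q := by
  cases h with
  | safe h => exact h.of_nil
  | step hb hr h1 hs =>
    intro N hN
    cases N with
    | zero => exact hb (bad_of_nil hN)
    | succ N =>
      rcases hN with hN | ⟨-, hN⟩
      · exact hb (bad_of_nil hN)
      · obtain ⟨r', hr', he, hl⟩ := hN _ h1
        exact hs r' hr' he N hl

/-- A choice of actions that preserves safety and leads from `CanReach` to safety. -/
theorem exists_strategy [Finite Γ] (R : List (Γ × (Γ → ℕ))) (Φ : List (Γ → ℕ)) (k : ℕ) :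
    ∃ (act : Cfg Γ → Option Γ) (rank : Cfg Γ → ℕ), ∀ q,
      ((act q = none ∧ q.1 = 0) ∨ ∃ X, act q = some X ∧ 1 ≤ q.1 X) ∧
      (Safe R Φ k q → ∀ r ∈ R, act q = some r.1 → Safe R Φ k (fire q r)) ∧
      (Safe R [] k q → ∀ r ∈ R, act q = some r.1 → Safe R [] k (fire q r)) ∧
      (CanReach R Φ k q → ¬ Safe R Φ k q → ¬ Bad Φ k q ∧
        ∃ r ∈ R, act q = some r.1 ∧ CanReach R Φ k (fire q r) ∧ rank (fire q r) < rank q) := by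
  -- The length of a shortest path to safety; the default `0` for positions without a path is never
  -- used.
  let rank : Cfg Γ → ℕ := fun q => sInf {n | ReachIn R Φ k n q}
  have key : ∀ q, ∃ a : Option Γ, ((a = none ∧ q.1 = 0) ∨ ∃ X, a = some X ∧ 1 ≤ q.1 X) ∧
      (Safe R Φ k q → ∀ r ∈ R, a = some r.1 → Safe R Φ k (fire q r)) ∧
      (Safe R [] k q → ∀ r ∈ R, a = some r.1 → Safe R [] k (fire q r)) ∧
      (CanReach R Φ k q → ¬ Safe R Φ k q → ¬ Bad Φ k q ∧
        ∃ r ∈ R, a = some r.1 ∧ CanReach R Φ k (fire q r) ∧ rank (fire q r) < rank q) := by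
    intro q
    -- Goals in order of priority: stay safe for the target, advance on a shortest path, stay safe
    -- for fairness, do anything enabled.
    by_cases hs : Safe R Φ k q
    · by_cases hq : ∃ X, 1 ≤ q.1 X
      · obtain ⟨X, hX, hsX⟩ := hs.exists_action hq
        refine ⟨some X, Or.inr ⟨X, rfl, hX⟩, fun _ r hr he => ?_, fun _ r hr he => ?_,
          fun _ h => absurd hs h⟩
        · exact hsX r hr (Option.some.inj he).symm
        · exact (hsX r hr (Option.some.inj he).symm).of_nil
      · refine ⟨none, Or.inl ⟨rfl, ?_⟩, by simp, by simp, fun _ h => absurd hs h⟩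
        ext X
        have := not_exists.1 hq X
        simp only [Pi.zero_apply]
        omega
    by_cases hc : CanReach R Φ k q
    · have hmem : ReachIn R Φ k (rank q) q := Nat.sInf_mem hc.exists_reachIn
      generalize hn : rank q = n at hmem
      cases n with
      | zero => exact absurd hmem hs
      | succ n =>
        obtain ⟨hb, r, hr, h1, hsib, hn'⟩ := hmem
        refine ⟨some r.1, Or.inr ⟨_, rfl, h1⟩, fun h => absurd h hs, fun _ r' hr' he => ?_,
          fun _ _ => ⟨hb, r, hr, rfl, hn'.canReach, ?_⟩⟩
        · exact hsib r' hr' (Option.some.inj he).symm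
        · exact Nat.lt_succ_of_le (Nat.sInf_le hn')
    by_cases hq : ∃ X, 1 ≤ q.1 X
    · by_cases hsn : Safe R [] k q
      · obtain ⟨X, hX, hsX⟩ := hsn.exists_action hq
        exact ⟨some X, Or.inr ⟨X, rfl, hX⟩, fun h => absurd h hs,
          fun _ r hr he => hsX r hr (Option.some.inj he).symm, fun h => absurd h hc⟩
      · obtain ⟨X, hX⟩ := hq
        exact ⟨some X, Or.inr ⟨X, rfl, hX⟩, fun h => absurd h hs, fun h => absurd h hsn,
          fun h => absurd h hc⟩
    · refine ⟨none, Or.inl ⟨rfl, ?_⟩, by simp, by simp, fun h => absurd h hc⟩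
      ext X
      have := not_exists.1 hq X
      simp only [Pi.zero_apply]
      omega
  choose act hact using key
  exact ⟨act, rank, hact⟩

end FairGame

/-! ### Waiting times along runs -/

namespace PBPP

open FairGame MDP
open scoped ENNReal

variable {Γ : Type} [DecidableEq Γ]

/-- The waiting times after the steps `w`. -/
def age (w : List (Step (Γ → ℕ) (Option Γ))) : Γ → ℕ :=
  w.foldl (fun c s => nextAge (s.state, c) s.act) (fun _ => 0)

theorem age_concat (w : List (Step (Γ → ℕ) (Option Γ))) (s : Step (Γ → ℕ) (Option Γ)) :
    age (w ++ [s]) = nextAge (s.state, age w) s.act := by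
  simp [age]

theorem age_pre_succ (ω : ℕ → Step (Γ → ℕ) (Option Γ)) (i : ℕ) (X : Γ) :
    age (pre (i + 1) ω) X = if (ω i).act = some X then 0
      else if 1 ≤ (ω i).state X then age (pre i ω) X + 1 else 0 := by
  rw [pre_succ, age_concat]
  rfl

/-- A waiting time of at least `j` records that the type was present and not chosen in each of the
last `j` steps. -/
theorem present_of_le_age {ω : ℕ → Step (Γ → ℕ) (Option Γ)} {X : Γ} :
    ∀ {i j : ℕ}, j ≤ age (pre i ω) X →
      j ≤ i ∧ ∀ l, i - j ≤ l → l < i → 1 ≤ (ω l).state X ∧ (ω l).act ≠ some X := by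
  intro i
  induction i with
  | zero =>
    intro j hj
    have : j = 0 := by simpa [pre, age] using hj
    exact ⟨this.le, fun l _ hl => by omega⟩
  | succ i ih =>
    intro j hj
    rw [age_pre_succ] at hj
    split_ifs at hj with h₁ h₂
    · exact ⟨by omega, fun l _ _ => by omega⟩
    · rcases j with - | j
      · exact ⟨by omega, fun l _ _ => by omega⟩
      · obtain ⟨hji, hl⟩ := ih (Nat.le_of_succ_le_succ hj)
        refine ⟨by omega, fun l h₃ h₄ => ?_⟩
        rcases Nat.lt_succ_iff_lt_or_eq.1 h₄ with h₅ | rfl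
        · exact hl l (by omega) h₅
        · exact ⟨h₂, h₁⟩
    · exact ⟨by omega, fun l _ _ => by omega⟩

theorem KFairRun.age_lt {k : ℕ} {ω : ℕ → Step (Γ → ℕ) (Option Γ)} (h : KFairRun k ω) {i : ℕ}
    {X : Γ} (hX : 1 ≤ (ω i).state X) : age (pre i ω) X < k := by
  by_contra! hk
  obtain ⟨hki, hl⟩ := present_of_le_age hk
  -- For `k = 0` the window of past steps is empty, and presence comes from `hX` instead.
  have hpres : 1 ≤ (ω (i - k)).state X := by
    rcases Nat.eq_zero_or_pos k with rfl | hpos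
    · exact hX
    · exact (hl (i - k) le_rfl (by omega)).1
  obtain ⟨j, hj, hact⟩ := h (i - k) X hpres
  exact (hl (i - k + j) (by omega) (by omega)).2 hact

/-- A type ignored for `k` steps persists through them, so its waiting time would reach `k` while it
is still present. -/
theorem kFairRun_of_age_lt {k : ℕ} {ω : ℕ → Step (Γ → ℕ) (Option Γ)}
    (hpersist : ∀ i X, 1 ≤ (ω i).state X → (ω i).act ≠ some X → 1 ≤ (ω (i + 1)).state X)
    (h : ∀ i X, 1 ≤ (ω i).state X → age (pre i ω) X < k) : KFairRun k ω := by
  intro i X hX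
  by_contra! hcon
  have key : ∀ j ≤ k, 1 ≤ (ω (i + j)).state X ∧ j ≤ age (pre (i + j) ω) X := by
    intro j
    induction j with
    | zero => exact fun _ => ⟨hX, Nat.zero_le _⟩
    | succ j ih =>
      intro hj
      obtain ⟨h₁, h₂⟩ := ih (by omega)
      have h₃ := hcon j (by omega)
      refine ⟨hpersist _ _ h₁ h₃, ?_⟩
      rw [← Nat.add_assoc, age_pre_succ, if_neg h₃, if_pos h₁]
      omega
  obtain ⟨h₁, h₂⟩ := key k le_rfl
  exact absurd (h _ _ h₁) (by omega)

variable [Fintype Γ] (S : PBPP Γ)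

theorem ruleDist_apply_of_mem {r : Γ × (Γ → ℕ)} (hr : r ∈ S.rules) :
    S.ruleDist r.1 r = ENNReal.ofReal ((S.prob r : ℚ) : ℝ) := by
  rw [ruleDist, PMF.ofFinset_apply]
  simp [hr]

theorem ofReal_prob_ne_zero {r : Γ × (Γ → ℕ)} (hr : r ∈ S.rules) :
    ENNReal.ofReal ((S.prob r : ℚ) : ℝ) ≠ 0 := by
  have := S.prob_pos r hr
  rw [Ne, ENNReal.ofReal_eq_zero, not_le]
  exact_mod_cast this

theorem le_trans_apply {r : Γ × (Γ → ℕ)} (hr : r ∈ S.rules) (q : Cfg Γ) :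
    ENNReal.ofReal ((S.prob r : ℚ) : ℝ) ≤ S.mdp.trans q.1 (some r.1) (fire q r).1 := by
  change _ ≤ ((S.ruleDist r.1).map fun r' => q.1 - Pi.single r.1 1 + r'.2) _
  rw [PMF.map_apply, ← S.ruleDist_apply_of_mem hr]
  refine le_trans ?_ (ENNReal.le_tsum r)
  exact (if_pos rfl).ge

theorem fire_mem_support {r : Γ × (Γ → ℕ)} (hr : r ∈ S.rules) (q : Cfg Γ) :
    (fire q r).1 ∈ (S.mdp.trans q.1 (some r.1)).support := fun h0 =>
  S.ofReal_prob_ne_zero hr (le_antisymm ((S.le_trans_apply hr q).trans h0.le) zero_le)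

theorem exists_le_prob : ∃ p : ℝ≥0∞, p ≠ 0 ∧ p ≤ 1 ∧
    ∀ r ∈ S.rules, p ≤ ENNReal.ofReal ((S.prob r : ℚ) : ℝ) := by
  have h : ∀ s ⊆ S.rules, ∃ p : ℝ≥0∞, p ≠ 0 ∧ p ≤ 1 ∧
      ∀ r ∈ s, p ≤ ENNReal.ofReal ((S.prob r : ℚ) : ℝ) := by
    intro s
    induction s using Finset.induction_on with
    | empty => exact fun _ => ⟨1, one_ne_zero, le_rfl, by simp⟩
    | insert r s _ ih =>
      intro hs
      obtain ⟨p, hp, hp1, hps⟩ := ih ((Finset.subset_insert r s).trans hs)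
      have hr := S.ofReal_prob_ne_zero (hs (Finset.mem_insert_self r s))
      refine ⟨min p (ENNReal.ofReal ((S.prob r : ℚ) : ℝ)), ?_, (min_le_left _ _).trans hp1, ?_⟩
      · rcases min_choice p (ENNReal.ofReal ((S.prob r : ℚ) : ℝ)) with h | h <;> rw [h]
        exacts [hp, hr]
      · intro r' hr'
        rcases Finset.mem_insert.1 hr' with rfl | hr'
        · exact min_le_right _ _
        · exact (min_le_left _ _).trans (hps r' hr')
  exact h _ subset_rfl

variable {S} {R : List (Γ × (Γ → ℕ))} {α₀ : Γ → ℕ} {σ : S.mdp.Scheduler}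
  {w : List (Step (Γ → ℕ) (Option Γ))}
  {c s : Step (Γ → ℕ) (Option Γ)}

theorem exists_rule_mem (hR : ∀ r, r ∈ R ↔ r ∈ S.rules) : ∀ X, ∃ r ∈ R, r.1 = X := fun X => by
  obtain ⟨β, hβ⟩ := S.exists_rule X
  exact ⟨(X, β), (hR _).2 hβ, rfl⟩

/-- Links runs to the game: a possible step is a move of the game, or the loop in the empty
configuration. -/
theorem possible_next (hR : ∀ r, r ∈ R ↔ r ∈ S.rules)
    (h : Possible S.mdp σ α₀ (w ++ [c] ++ [s])) :
    (c.act = none ∧ s.state = c.state ∧ c.state = 0) ∨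
      ∃ r ∈ R, c.act = some r.1 ∧ 1 ≤ c.state r.1 ∧
        (s.state, age (w ++ [c])) = fire (c.state, age w) r := by
  obtain ⟨h₁, h₂, -⟩ := possible_concat.1 h
  rcases h₁.act_enabled with ⟨hn, h0⟩ | ⟨X, hX, h1⟩
  · rw [hn] at h₂
    exact Or.inl ⟨hn, by simpa [mdp] using h₂, h0⟩
  · rw [hX] at h₂
    change s.state ∈ ((S.ruleDist X).map fun r => c.state - Pi.single X 1 + r.2).support at h₂
    rw [PMF.support_map] at h₂
    obtain ⟨r, hr, hs⟩ := h₂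
    obtain ⟨hrS, rfl⟩ : r ∈ S.rules ∧ r.1 = X := by
      rw [ruleDist, PMF.mem_support_ofFinset_iff] at hr
      exact Finset.mem_filter.1 hr.1
    refine Or.inr ⟨r, (hR r).2 hrS, hX, h1, ?_⟩
    rw [age_concat, hX, ← hs]
    rfl

end PBPP

/-! ### `k`-fair schedulers and the fairness game -/

namespace PBPP

open FairGame MDP
open scoped ENNReal

variable {Γ : Type} [Fintype Γ] [DecidableEq Γ] {S : PBPP Γ} {R : List (Γ × (Γ → ℕ))}
  {Φ : List (Γ → ℕ)} {α₀ : Γ → ℕ} {k : ℕ} {σ : S.mdp.Scheduler}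
  {w : List (Step (Γ → ℕ) (Option Γ))} {c s : Step (Γ → ℕ) (Option Γ)}

/-- Under a `k`-fair scheduler, all configurations that occur are safe for fairness. -/
theorem KFair.safe_of_possible (hR : ∀ r, r ∈ R ↔ r ∈ S.rules) (hk : S.KFair α₀ k σ)
    (h : Possible S.mdp σ α₀ (w ++ [s])) : Safe R [] k (s.state, age w) := by
  refine InductiveUpTo.safe (exists_rule_mem hR)
    (I := {q | ∃ w s, Possible S.mdp σ α₀ (w ++ [s]) ∧ q = (s.state, age w)}) ?_ ⟨w, s, h, rfl⟩
  rintro q ⟨w, s, h, rfl⟩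
  refine ⟨?_, ?_⟩
  · rintro (⟨φ, hφ, -⟩ | ⟨X, hX, hkX⟩)
    · simp at hφ
    · refine h ?_
      -- A late position would make the whole cylinder, which has positive probability, consist of
      -- runs that are not `k`-fair.
      refine measure_mono_null (t := {ω | ¬ KFairRun k ω}) (fun ω hω hfair => ?_) (ae_iff.1 hk)
      obtain ⟨h₁, h₂⟩ := mem_cyl_concat.1 hω
      rw [mem_cyl] at h₁
      have := KFairRun.age_lt hfair (i := w.length) (X := X) (by rwa [h₂])
      rw [h₁] at this
      exact absurd hkX (not_le.2 this)
  · rcases h.act_enabled with ⟨-, h0⟩ | ⟨X, hX, h1⟩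
    · exact Or.inl fun X => congrFun h0 X
    · refine Or.inr ⟨X, h1, fun r hr hrX => ?_⟩
      subst hrX
      have hsupp := S.fire_mem_support ((hR r).1 hr) (s.state, age w)
      rw [← hX] at hsupp
      obtain ⟨b, hb⟩ := h.exists_concat hsupp
      refine ⟨_, ⟨_, _, hb, rfl⟩, ?_⟩
      rw [age_concat, hX]
      exact Below.refl _

/-- `CanReach` would propagate backwards along a possible step that starts outside `F`: all other
outcomes of the same action are possible too, hence safe for fairness because the scheduler is
`k`-fair. -/
theorem KFair.not_canReach_of_possible (hR : ∀ r, r ∈ R ↔ r ∈ S.rules) (hk : S.KFair α₀ k σ)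
    {F : Set (Γ → ℕ)} (hF : ∀ β, β ∈ F ↔ ∃ φ ∈ Φ, φ ≤ β)
    (h0 : ¬ CanReach R Φ k (α₀, fun _ => 0)) :
    ∀ {w : List (Step (Γ → ℕ) (Option Γ))} {s : Step (Γ → ℕ) (Option Γ)},
      Possible S.mdp σ α₀ (w ++ [s]) → (∀ u ∈ w, u.state ∉ F) →
        ¬ CanReach R Φ k (s.state, age w) := by
  intro w
  induction w using List.reverseRecOn with
  | nil =>
    intro s h _
    rw [(possible_singleton.1 h).1]
    exact h0
  | append_singleton w c ih =>
    intro s h hw hreach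
    have hc := (possible_concat.1 h).1
    have hnF : c.state ∉ F := hw c (by simp)
    have hnc := ih hc fun u hu => hw u (List.mem_append_left _ hu)
    rcases possible_next hR h with ⟨hn, he, hz⟩ | ⟨r, hr, hact, h1, he⟩
    · refine hnc (hreach.of_below (exists_rule_mem hR) fun X => ?_)
      simp [hz]
    · rw [he] at hreach
      refine hnc (.step ?_ hr h1 ?_ hreach)
      · rintro (hφ | hlate)
        · exact hnF ((hF _).2 hφ)
        · exact (hk.safe_of_possible hR hc).not_bad (Or.inr hlate)
      · intro r' hr' hrr
        have hsupp := S.fire_mem_support ((hR r').1 hr') (c.state, age w)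
        rw [hrr, ← hact] at hsupp
        obtain ⟨b, hb⟩ := hc.exists_concat hsupp
        have := hk.safe_of_possible hR hb
        rw [age_concat, hact, ← hrr] at this
        exact this

/-- Losing configurations hit the target with probability bounded from below. -/
theorem KFair.pow_mul_le (hR : ∀ r, r ∈ R ↔ r ∈ S.rules) (hk : S.KFair α₀ k σ)
    {F : Set (Γ → ℕ)} (hF : ∀ β, β ∈ F ↔ ∃ φ ∈ Φ, φ ≤ β) {p : ℝ≥0∞} (hp1 : p ≤ 1)
    (hp : ∀ r ∈ S.rules, p ≤ ENNReal.ofReal ((S.prob r : ℚ) : ℝ)) (N : ℕ) :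
    ∀ {w : List (Step (Γ → ℕ) (Option Γ))} {s : Step (Γ → ℕ) (Option Γ)},
      Lose R Φ k N (s.state, age w) → p ^ N * S.mdp.runMeasure σ α₀ (cyl (w ++ [s])) ≤
        S.mdp.runMeasure σ α₀ (cyl (w ++ [s]) ∩ reach F) := by
  -- Lateness cannot occur on a possible history, so a bad position must lie in `F`.
  have hbad : ∀ N (w : List (Step (Γ → ℕ) (Option Γ))) (s : Step (Γ → ℕ) (Option Γ)),
      Possible S.mdp σ α₀ (w ++ [s]) → Bad Φ k (s.state, age w) →
      p ^ N * S.mdp.runMeasure σ α₀ (cyl (w ++ [s])) ≤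
        S.mdp.runMeasure σ α₀ (cyl (w ++ [s]) ∩ reach F) := by
    rintro N w s hpos (hφ | hlate)
    · refine (mul_le_of_le_one_left zero_le (pow_le_one' hp1 N)).trans
        (measure_mono fun ω hω => ⟨hω, w.length, ?_⟩)
      rw [(mem_cyl_concat.1 hω).2]
      exact (hF _).2 hφ
    · exact absurd (Or.inr hlate) (hk.safe_of_possible hR hpos).not_bad
  induction N with
  | zero =>
    intro w s h
    by_cases hpos : Possible S.mdp σ α₀ (w ++ [s])
    · exact hbad 0 w s hpos h
    · rw [not_not.1 hpos, mul_zero]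
      exact zero_le
  | succ N ih =>
    intro w s h
    by_cases hpos : Possible S.mdp σ α₀ (w ++ [s])
    swap
    · rw [not_not.1 hpos, mul_zero]
      exact zero_le
    rcases h with h | ⟨⟨X₀, hX₀⟩, h⟩
    · exact hbad _ w s hpos h
    rcases hpos.act_enabled with ⟨-, h0⟩ | ⟨X, hX, h1⟩
    · have := congrFun h0 X₀
      simp only [Pi.zero_apply] at this
      simp only at hX₀
      omega
    · obtain ⟨r, hr, rfl, hl⟩ := h X h1
      have hrS := (hR r).1 hr
      set t : Γ → ℕ := (fire (s.state, age w) r).1 with ht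
      have hl' : Lose R Φ k N (t, age (w ++ [s])) := by
        rw [age_concat, hX]
        exact hl
      set μ := S.mdp.runMeasure σ α₀ with hμ
      -- Only the adversary's winning rule is kept, at the cost of a factor `p`; the sum over `b`
      -- absorbs the randomised next choice of the scheduler.
      calc p ^ (N + 1) * μ (cyl (w ++ [s]))
          = p ^ N * (μ (cyl (w ++ [s])) * p) := by ring
        _ ≤ p ^ N * (μ (cyl (w ++ [s])) * S.mdp.trans s.state s.act t) := by
          gcongr
          rw [hX]
          exact (hp r hrS).trans (S.le_trans_apply hrS _)
        _ = ∑' b, p ^ N * μ (cyl (w ++ [s] ++ [⟨t, b⟩])) := by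
          simp_rw [hμ, runMeasure_cyl_concat, nextStep_apply, ← mul_assoc]
          rw [ENNReal.tsum_mul_left, PMF.tsum_coe, mul_one]
        _ ≤ ∑' b, μ (cyl (w ++ [s] ++ [⟨t, b⟩]) ∩ reach F) := by
          exact ENNReal.tsum_le_tsum fun b => ih (s := ⟨t, b⟩) hl'
        _ = μ (⋃ b, cyl (w ++ [s] ++ [⟨t, b⟩]) ∩ reach F) := by
          rw [measure_iUnion]
          · intro b b' hne
            refine Set.disjoint_left.2 fun ω h₁ h₂ => hne ?_
            have := (mem_cyl_concat.1 h₁.1).2.symm.trans (mem_cyl_concat.1 h₂.1).2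
            exact congrArg Step.act this
          · exact fun b => (measurableSet_cyl _).inter (measurableSet_reach F)
        _ ≤ μ (cyl (w ++ [s]) ∩ reach F) := by
          refine measure_mono (Set.iUnion_subset fun b ω hω => ⟨?_, hω.2⟩)
          exact (mem_cyl_concat.1 hω.1).1

/-- With `E m` the event that `F` is avoided in the steps up to index `m`, the uniform bound gives
`p ^ N * μ (E m) ≤ μ (E m ∩ reach F)`. The right side tends to `0`, while the left side is at least
`p ^ N * μ (reach F)ᶜ`. -/
theorem kFairUniversal_of_not_canReach (hR : ∀ r, r ∈ R ↔ r ∈ S.rules) {F : Set (Γ → ℕ)}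
    (hF : ∀ β, β ∈ F ↔ ∃ φ ∈ Φ, φ ≤ β) (h0 : ¬ CanReach R Φ k (α₀, fun _ => 0)) :
    S.KFairUniversal F α₀ k := by
  intro σ hk
  obtain ⟨p, hp0, hp1, hp⟩ := S.exists_le_prob
  obtain ⟨N, hN⟩ := exists_uniform_lose (exists_rule_mem hR) Φ k
  set μ := S.mdp.runMeasure σ α₀ with hμ
  let E : ℕ → Set (ℕ → Step (Γ → ℕ) (Option Γ)) := fun m => {ω | ∀ s ∈ pre (m + 1) ω, s.state ∉ F}
  have hE : ∀ m, MeasurableSet (E m) := fun m => measurableSet_pre _ fun w => ∀ s ∈ w, s.state ∉ F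
  have hmem : ∀ m ω, ω ∈ E m ↔ ∀ i < m + 1, (ω i).state ∉ F := fun m ω => by
    simp [E, pre]
  have hle : ∀ m, p ^ N * μ (reach F)ᶜ ≤ μ (E m ∩ reach F) := by
    intro m
    calc p ^ N * μ (reach F)ᶜ ≤ p ^ N * μ (E m) := by
          gcongr
          exact fun ω hω => (hmem m ω).2 fun i _ hi => hω ⟨i, hi⟩
      _ = (p ^ N • μ) (E m) := rfl
      _ ≤ (μ.restrict (reach F)) (E m) := by
          refine measure_pre_le (m + 1) (fun w => ∀ s ∈ w, s.state ∉ F) fun w hw hwF => ?_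
          rw [Measure.restrict_apply (measurableSet_cyl w), Measure.smul_apply, smul_eq_mul]
          rcases List.eq_nil_or_concat' w with rfl | ⟨w, s, rfl⟩
          · simp at hw
          · by_cases hpos : Possible S.mdp σ α₀ (w ++ [s])
            · refine hk.pow_mul_le hR hF hp1 hp N (hN _ fun hs => ?_)
              exact hk.not_canReach_of_possible hR hF h0 hpos
                (fun u hu => hwF u (List.mem_append_left _ hu)) (.safe hs)
            · rw [not_not.1 hpos, mul_zero]
              exact zero_le
      _ = μ (E m ∩ reach F) := Measure.restrict_apply (hE m)
  -- These events decrease to the empty set: a run that reaches `F` does so at some finite index.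
  have hlim : Filter.Tendsto (fun m => μ (E m ∩ reach F)) Filter.atTop (nhds 0) := by
    have hempty : ⋂ m, E m ∩ reach F = ∅ := by
      refine Set.eq_empty_of_forall_notMem fun ω hω => ?_
      rw [Set.mem_iInter] at hω
      obtain ⟨i, hi⟩ := (hω 0).2
      exact (hmem i ω).1 (hω i).1 i (Nat.lt_succ_self i) hi
    rw [← measure_empty (μ := μ), ← hempty]
    refine tendsto_measure_iInter_atTop
      (fun m => ((hE m).inter (measurableSet_reach F)).nullMeasurableSet) ?_
      ⟨0, measure_ne_top _ _⟩
    exact fun m m' hmm ω hω =>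
      ⟨(hmem m ω).2 fun i hi => (hmem m' ω).1 hω.1 i (by omega), hω.2⟩
  have hzero : p ^ N * μ (reach F)ᶜ = 0 := le_antisymm (ge_of_tendsto' hlim hle) zero_le
  rw [mul_eq_zero, or_iff_right (pow_ne_zero N hp0)] at hzero
  exact (prob_compl_eq_zero_iff (measurableSet_reach F)).1 hzero

/-- Safety is inherited by the next configuration if the chosen action preserves it. -/
theorem safe_next (hR : ∀ r, r ∈ R ↔ r ∈ S.rules)
    (h : Possible S.mdp σ α₀ (w ++ [c] ++ [s])) (hc : Safe R Φ k (c.state, age w))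
    (hact : ∀ r ∈ R, c.act = some r.1 → Safe R Φ k (fire (c.state, age w) r)) :
    Safe R Φ k (s.state, age (w ++ [c])) := by
  rcases possible_next hR h with ⟨-, he, hz⟩ | ⟨r, hr, ha, -, he⟩
  · refine hc.of_below (exists_rule_mem hR) fun X => ?_
    simp [he, hz]
  · rw [he]
    exact hact r hr ha

/-- The deterministic scheduler that plays `act` on the current configuration and waiting times is
`k`-fair. It reaches the safe region without visiting `F` on a cylinder of positive probability, and
from there never meets `F`. -/
theorem not_kFairUniversal_of_canReach (hR : ∀ r, r ∈ R ↔ r ∈ S.rules) {F : Set (Γ → ℕ)}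
    (hF : ∀ β, β ∈ F ↔ ∃ φ ∈ Φ, φ ≤ β) (h0 : CanReach R Φ k (α₀, fun _ => 0)) :
    ¬ S.KFairUniversal F α₀ k := by
  obtain ⟨act, rank, hact⟩ := exists_strategy R Φ k
  let σ : S.mdp.Scheduler :=
    { choose := fun x => PMF.pure (act (x.2, age x.1))
      support_subset := fun x a ha => by
        obtain rfl : a = act (x.2, age x.1) := by simpa using ha
        exact (hact (x.2, age x.1)).1 }
  have hσ : ∀ {w : List (Step (Γ → ℕ) (Option Γ))} {s : Step (Γ → ℕ) (Option Γ)},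
      Possible S.mdp σ α₀ (w ++ [s]) → s.act = act (s.state, age w) := fun h => by
    simpa [σ] using h.act_mem
  have hsafe : ∀ {w : List (Step (Γ → ℕ) (Option Γ))} {s : Step (Γ → ℕ) (Option Γ)},
      Possible S.mdp σ α₀ (w ++ [s]) → Safe R [] k (s.state, age w) := by
    intro w
    induction w using List.reverseRecOn with
    | nil =>
      intro s h
      rw [(possible_singleton.1 h).1]
      exact h0.safe_nil
    | append_singleton w c ih =>
      intro s h
      have hc := (possible_concat.1 h).1
      refine safe_next hR h (ih hc) fun r hr ha => ?_
      exact (hact (c.state, age w)).2.2.1 (ih hc) r hr ((hσ hc).symm.trans ha)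
  have hfair : S.KFair α₀ k σ := by
    filter_upwards [ae_possible S.mdp σ α₀] with ω hω
    refine kFairRun_of_age_lt (fun i X hX hne => ?_) fun i X hX => ?_
    · have h := hω (i + 2)
      rw [pre_succ, pre_succ] at h
      rcases possible_next hR h with ⟨-, he, -⟩ | ⟨r, -, ha, -, he⟩
      · rwa [he]
      · have he' : (ω (i + 1)).state X = _ := congrFun (congrArg Prod.fst he) X
        rw [fire_fst_apply, if_neg (by rintro rfl; exact hne ha)] at he'
        simp only at he'
        omega
    · have h := hω (i + 1)
      rw [pre_succ] at h
      by_contra! hlate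
      exact (hsafe h).not_bad (Or.inr ⟨X, hX, hlate⟩)
  -- Induction on the rank: the rule that decreases it has positive probability, so the extended
  -- history is still possible.
  have hex : ∀ n, ∀ (w : List (Step (Γ → ℕ) (Option Γ))) (s : Step (Γ → ℕ) (Option Γ)),
      rank (s.state, age w) < n → Possible S.mdp σ α₀ (w ++ [s]) →
      CanReach R Φ k (s.state, age w) → (∀ u ∈ w, u.state ∉ F) →
      ∃ (w' : List (Step (Γ → ℕ) (Option Γ))) (s' : Step (Γ → ℕ) (Option Γ)),
        Possible S.mdp σ α₀ (w' ++ [s']) ∧ Safe R Φ k (s'.state, age w') ∧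
        ∀ u ∈ w', u.state ∉ F := by
    intro n
    induction n with
    | zero => intro w s h; omega
    | succ n ih =>
      intro w s hn h hc hw
      by_cases hs : Safe R Φ k (s.state, age w)
      · exact ⟨w, s, h, hs, hw⟩
      · obtain ⟨hb, r, hr, ha, hcr, hlt⟩ := (hact (s.state, age w)).2.2.2 hc hs
        rw [← hσ h] at ha
        have hsupp := S.fire_mem_support ((hR r).1 hr) (s.state, age w)
        rw [← ha] at hsupp
        obtain ⟨b, hpb⟩ := h.exists_concat hsupp
        have he : ((fire (s.state, age w) r).1, age (w ++ [s])) = fire (s.state, age w) r := by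
          rw [age_concat, ha]
          rfl
        refine ih (w ++ [s]) ⟨(fire (s.state, age w) r).1, b⟩ ?_ hpb ?_ fun u hu => ?_
        · rw [he]
          omega
        · rw [he]
          exact hcr
        · rcases List.mem_append.1 hu with hu | hu
          · exact hw u hu
          · rw [List.mem_singleton.1 hu]
            exact fun hsF => hb (Or.inl ((hF _).1 hsF))
  obtain ⟨w, s, hp, hs, hw⟩ := hex _ [] ⟨α₀, act (α₀, fun _ => 0)⟩ (Nat.lt_succ_self _)
    (possible_singleton.2 ⟨rfl, by simp [σ, age]⟩) h0 (by simp)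
  intro huniv
  have hone : ∀ᵐ ω ∂(S.mdp.runMeasure σ α₀), ω ∈ reach F :=
    (mem_ae_iff_prob_eq_one (measurableSet_reach F)).2 (huniv σ hfair)
  refine hp (measure_mono_null (fun ω hω => ?_) (hone.and (ae_possible S.mdp σ α₀)))
  rintro ⟨⟨i, hi⟩, hpos⟩
  obtain ⟨hω₁, hω₂⟩ := mem_cyl_concat.1 hω
  rw [mem_cyl] at hω₁
  rcases lt_or_ge i w.length with hlt | hge
  · refine hw (ω i) ?_ hi
    rw [← hω₁]
    exact List.mem_map_of_mem (List.mem_range.2 hlt)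
  -- Once the run is in the safe region, every possible continuation under `act` remains there.
  · have hall : ∀ j ≥ w.length, Safe R Φ k ((ω j).state, age (pre j ω)) := by
      intro j hj
      induction j, hj using Nat.le_induction with
      | base => rwa [hω₁, hω₂]
      | succ j hj ih =>
        have h := hpos (j + 2)
        rw [pre_succ, pre_succ] at h
        rw [pre_succ]
        refine safe_next hR h ih fun r hr ha => ?_
        exact (hact _).2.1 ih r hr ((hσ (possible_concat.1 h).1).symm.trans ha)
    exact (hall i hge).not_bad (Or.inl ((hF _).1 hi))

theorem kFairUniversal_iff (hR : ∀ r, r ∈ R ↔ r ∈ S.rules) {F : Set (Γ → ℕ)}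
    (hF : ∀ β, β ∈ F ↔ ∃ φ ∈ Φ, φ ≤ β) :
    S.KFairUniversal F α₀ k ↔ ¬ CanReach R Φ k (α₀, fun _ => 0) :=
  ⟨fun h hc => not_kFairUniversal_of_canReach hR hF hc h, kFairUniversal_of_not_canReach hR hF⟩

end PBPP

theorem mainTheorem3 :
    ∃ f : PBPP.InstanceCode → Bool, Computable f ∧
      ∀ (n : ℕ) (S : PBPP (Fin n)) (L : List (Fin n × (Fin n → ℕ)))
        (F : Set (Fin n → ℕ)) (Φ : List (Fin n → ℕ)) (α₀ : Fin n → ℕ) (k : ℕ),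
        L.Nodup → (∀ r, r ∈ L ↔ r ∈ S.rules) →
        IsUpperSet F → (∀ β, β ∈ F ↔ ∃ φ ∈ Φ, φ ≤ β) →
        (f (S.instanceCode L Φ α₀ k) = true ↔ S.KFairUniversal F α₀ k) := by
  obtain ⟨f, hf, hfs⟩ := FairGame.exists_computable_canReach
  refine ⟨f, hf, fun n S L F Φ α₀ k _ hL _ hF => ?_⟩
  -- Decoding discards the probabilities: the answer depends only on which rules exist.
  have hrules : FairGame.rulesOf n (S.instanceCode L Φ α₀ k).2.1 = L := by
    simp [PBPP.instanceCode, FairGame.rulesOf, List.filterMap_map, FairGame.vec_ofFn]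
  have hΦ : (S.instanceCode L Φ α₀ k).2.2.1.map (FairGame.vec n) = Φ := by
    simp [PBPP.instanceCode, Function.comp_def, FairGame.vec_ofFn]
  have hα : FairGame.vec n (S.instanceCode L Φ α₀ k).2.2.2.1 = α₀ := FairGame.vec_ofFn α₀
  have h := hfs (S.instanceCode L Φ α₀ k)
  change (∀ X, ∃ r ∈ FairGame.rulesOf n _, r.1 = X) →
    (_ ↔ ¬ FairGame.CanReach (FairGame.rulesOf n _) (List.map (FairGame.vec n) _) k
      (FairGame.vec n _, fun _ => 0)) at h
  rw [hrules, hΦ, hα] at h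
  rw [h (PBPP.exists_rule_mem hL), PBPP.kFairUniversal_iff hL hF]
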